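/- Let $M|N$ be a ring extension, i.e. a ring homomorphism $\iota\colon N\to M$ of unital rings, and view $M$ as an $N$-bimodule through $\iota$. Assume that $M|N$ is left depth two: for some $k>0$ the $N$-$M$-bimodule $M\otimes_N M$ is isomorphic to a direct summand of $M^k$. Put $R=C_M(N)$ (the centralizer of $\iota(N)$ in $M$), $A=\mathrm{End}({}_NM_N)$ and $B=(M\otimes_N M)^N$. Write $\lambda(m)(x)=mx$ and $\rho(m)(x)=xm$. Then there is a left bialgebroid structure on $A$ over $R$ with source $s(r)=\lambda(r)$, target $t(r)=\rho(r)$, counit $\varepsilon(\alpha)=\alpha(1)$ and coproduct $$\Delta(\alpha)=\sum_i \alpha(-\,b_i^1)\,b_i^2\otimes_R\beta_i$$ for every left depth-two quasibasis, that is, every finite family $b_i\in B$, $\beta_i\in A$ with $\sum_i b_i^1\otimes b_i^2\beta_i(m)=m\otimes 1$ for all $m\in M$; such quasibases exist. Moreover $\Delta(\alpha)=\sum_j\gamma_j\otimes_R c_j^1\alpha(c_j^2\,-)$ for every right quasibasis, that is, every finite family $c_j\in B$, $\gamma_j\in A$ with $\sum_j\gamma_j(m)c_j^1\otimes c_j^2=1\otimes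 m$ for all $m\in M$. With the action $\alpha\triangleright m=\alpha(m)$, the ring $M$ is a left $A$-module algebroid, so that the smash product ring $M\rtimes A$ is defined: it is $M\otimes_R A$ with the multiplication $(m\rtimes\alpha)(m'\rtimes\alpha')=m\,\alpha_{(1)}(m')\rtimes\alpha_{(2)}\alpha'$. With these structures: 1. The map $M\rtimes A\to \mathrm{End}(M_N)$, $m\rtimes\alpha\mapsto\lambda(m)\circ\alpha$, is an isomorphism of rings. 2. If $M|N$ is moreover Frobenius, with an $N$-$N$-bimodule map $E\colon M\to N$ and $x_i,y_i\in M$ such that $\sum_i x_iE(y_im)=m=\sum_i E(mx_i)y_i$ for all $m\in M$, let $M_1$ be $M\otimes_N M$ with the multiplication $(m\otimes m')(m''\otimes m''')=mE(m'm'')\otimes m'''$ and the unit $\sum_i x_i\otimes y_i$. Then the map $M\rtimes A\to M_1$, $m\rtimes\alpha\mapsto\sum_i m\,\alpha(x_i)\otimes y_i$, is an isomorphism of rings. -/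

import Mathlib

/-! ### Tensor products over a noncommutative ring

`X` is an additive group with a right action `ρ` of `R`, `Y` one with a left action `l` of `R`.
`BalTensor ρ l` is the tensor product of `X` and `Y` over `R`, that is, the quotient of the tensor
product over `ℤ` by the relations `x · r ⊗ y = x ⊗ r · y`. -/

section BalTensor

variable {R X Y X' Y' Z : Type*} [AddCommGroup X] [AddCommGroup Y] [AddCommGroup X']
  [AddCommGroup Y'] [AddCommGroup Z]

/-- The relations `x · r ⊗ y - x ⊗ r · y`. -/
def balRel (ρ : R → AddMonoid.End X) (l : R → AddMonoid.End Y) :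
    AddSubgroup (TensorProduct ℤ X Y) :=
  AddSubgroup.closure
    {z | ∃ r x y, z = TensorProduct.tmul ℤ (ρ r x) y - TensorProduct.tmul ℤ x (l r y)}

/-- The tensor product over `R` of `X` (right action `ρ`) and `Y` (left action `l`). -/
def BalTensor (ρ : R → AddMonoid.End X) (l : R → AddMonoid.End Y) : Type _ :=
  TensorProduct ℤ X Y ⧸ balRel ρ l

namespace BalTensor

instance (ρ : R → AddMonoid.End X) (l : R → AddMonoid.End Y) : AddCommGroup (BalTensor ρ l) :=
  inferInstanceAs (AddCommGroup (TensorProduct ℤ X Y ⧸ balRel ρ l))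

variable {ρ : R → AddMonoid.End X} {l : R → AddMonoid.End Y}
  {ρ' : R → AddMonoid.End X'} {l' : R → AddMonoid.End Y'}

/-- The quotient map from the tensor product over `ℤ`. -/
def proj (ρ : R → AddMonoid.End X) (l : R → AddMonoid.End Y) :
    TensorProduct ℤ X Y →+ BalTensor ρ l :=
  QuotientAddGroup.mk' (balRel ρ l)

/-- The class of the elementary tensor `x ⊗ y`. -/
def mk (ρ : R → AddMonoid.End X) (l : R → AddMonoid.End Y) (x : X) (y : Y) : BalTensor ρ l :=
  proj ρ l (TensorProduct.tmul ℤ x y)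

theorem add_mk (x x' : X) (y : Y) : mk ρ l (x + x') y = mk ρ l x y + mk ρ l x' y := by
  simp only [mk, TensorProduct.add_tmul, map_add]

theorem mk_add (x : X) (y y' : Y) : mk ρ l x (y + y') = mk ρ l x y + mk ρ l x y' := by
  simp only [mk, TensorProduct.tmul_add, map_add]

theorem mk_bal (r : R) (x : X) (y : Y) : mk ρ l (ρ r x) y = mk ρ l x (l r y) := by
  rw [← sub_eq_zero, mk, mk, ← map_sub]
  exact (QuotientAddGroup.eq_zero_iff _).2 (AddSubgroup.subset_closure ⟨r, x, y, rfl⟩)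

theorem induction {p : BalTensor ρ l → Prop} (z : BalTensor ρ l) (h0 : p 0)
    (h1 : ∀ x y, p (mk ρ l x y)) (h2 : ∀ z w, p z → p w → p (z + w)) : p z := by
  obtain ⟨z, rfl⟩ : ∃ w, proj ρ l w = z := QuotientAddGroup.mk'_surjective (balRel ρ l) z
  induction z using TensorProduct.induction_on with
  | zero => rw [map_zero]; exact h0
  | tmul x y => exact h1 x y
  | add z w hz hw => rw [map_add]; exact h2 _ _ hz hw

theorem exists_sum (z : BalTensor ρ l) :
    ∃ (n : ℕ) (x : Fin n → X) (y : Fin n → Y), z = ∑ i, mk ρ l (x i) (y i) := by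
  induction z using BalTensor.induction with
  | h0 => exact ⟨0, Fin.elim0, Fin.elim0, by simp⟩
  | h1 x y => exact ⟨1, fun _ => x, fun _ => y, by simp⟩
  | h2 z w hz hw =>
    obtain ⟨n, x, y, rfl⟩ := hz
    obtain ⟨n', x', y', rfl⟩ := hw
    exact ⟨n + n', Fin.append x x', Fin.append y y', by simp [Fin.sum_univ_add]⟩

/-- The universal property: a biadditive balanced map factors through the tensor product. -/
def lift (f : X → Y → Z) (hl : ∀ x x' y, f (x + x') y = f x y + f x' y)
    (hr : ∀ x y y', f x (y + y') = f x y + f x y') (hb : ∀ r x y, f (ρ r x) y = f x (l r y)) :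
    BalTensor ρ l →+ Z :=
  QuotientAddGroup.lift (balRel ρ l)
    (TensorProduct.liftAddHom
      (AddMonoidHom.mk' (fun x => AddMonoidHom.mk' (f x) (hr x))
        (fun x x' => AddMonoidHom.ext (hl x x')))
      (fun n x y => by rw [map_zsmul, map_zsmul]; rfl))
    (by
      rw [balRel, AddSubgroup.closure_le]
      rintro _ ⟨r, x, y, rfl⟩
      rw [SetLike.mem_coe, AddMonoidHom.mem_ker, map_sub, sub_eq_zero]
      exact hb r x y)

theorem lift_mk (f : X → Y → Z) (hl : ∀ x x' y, f (x + x') y = f x y + f x' y)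
    (hr : ∀ x y y', f x (y + y') = f x y + f x y') (hb : ∀ r x y, f (ρ r x) y = f x (l r y))
    (x : X) (y : Y) : lift f hl hr hb (mk ρ l x y) = f x y := rfl

theorem hom_ext {f g : BalTensor ρ l →+ Z} (h : ∀ x y, f (mk ρ l x y) = g (mk ρ l x y)) :
    f = g := by
  ext z
  induction z using BalTensor.induction with
  | h0 => simp
  | h1 x y => exact h x y
  | h2 z w hz hw => rw [map_add, map_add, hz, hw]

/-- The map `f ⊗ g` of two `R`-linear maps `f` and `g`. -/
def map (f : X →+ X') (g : Y →+ Y') (hf : ∀ r x, f (ρ r x) = ρ' r (f x))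
    (hg : ∀ r y, g (l r y) = l' r (g y)) : BalTensor ρ l →+ BalTensor ρ' l' :=
  lift (fun x y => mk ρ' l' (f x) (g y))
    (fun x x' y => by rw [map_add, add_mk]) (fun x y y' => by rw [map_add, mk_add])
    (fun r x y => by rw [hf, hg, mk_bal])

theorem map_mk (f : X →+ X') (g : Y →+ Y') (hf : ∀ r x, f (ρ r x) = ρ' r (f x))
    (hg : ∀ r y, g (l r y) = l' r (g y)) (x : X) (y : Y) :
    map (ρ := ρ) (l := l) f g hf hg (mk ρ l x y) = mk ρ' l' (f x) (g y) := rfl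

end BalTensor

end BalTensor

/-! ### Left bialgebroids -/

/-- A source map `s : R → A` and a target map `t : Rᵒᵖ → A` with commuting images. -/
structure SourceTarget (R A : Type*) [Ring R] [Ring A] where
  s : R →+* A
  t : Rᵐᵒᵖ →+* A
  comm : ∀ r r', s r * t (MulOpposite.op r') = t (MulOpposite.op r') * s r

namespace SourceTarget

variable {R A : Type*} [Ring R] [Ring A] (S : SourceTarget R A)

/-- The left action `r · a = s(r) a`. -/
def lAct (r : R) : AddMonoid.End A := AddMonoidHom.mulLeft (S.s r)

/-- The right action `a · r = t(r) a`. -/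
def rAct (r : R) : AddMonoid.End A := AddMonoidHom.mulLeft (S.t (MulOpposite.op r))

/-- `A ⊗_R A` for the bimodule structure `r · a · r' = s(r) t(r') a`. -/
abbrev Tensor : Type _ := BalTensor S.rAct S.lAct

/-- The elementary tensor `a ⊗ b`. -/
abbrev tmul (a b : A) : S.Tensor := BalTensor.mk S.rAct S.lAct a b

/-- The left `R`-action `r · (a ⊗ b) = s(r) a ⊗ b` on `A ⊗_R A`. -/
def lActTensor (r : R) : AddMonoid.End S.Tensor :=
  BalTensor.map (S.lAct r) (AddMonoidHom.id A)
    (fun r' a => by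
      change S.s r * (S.t _ * a) = S.t _ * (S.s r * a)
      rw [← mul_assoc, ← mul_assoc, S.comm])
    (fun _ _ => rfl)

/-- The right `R`-action `(a ⊗ b) · r = a ⊗ t(r) b` on `A ⊗_R A`. -/
def rActTensor (r : R) : AddMonoid.End S.Tensor :=
  BalTensor.map (AddMonoidHom.id A) (S.rAct r) (fun _ _ => rfl)
    (fun r' a => by
      change S.t _ * (S.s r' * a) = S.s r' * (S.t _ * a)
      rw [← mul_assoc, ← mul_assoc, S.comm])

/-- Right multiplication `a ⊗ a' ↦ a b ⊗ a' b'` by `b ⊗ b'`. -/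
def rmul (b b' : A) : S.Tensor →+ S.Tensor :=
  BalTensor.map (AddMonoidHom.mulRight b) (AddMonoidHom.mulRight b')
    (fun _ _ => mul_assoc _ _ _) (fun _ _ => mul_assoc _ _ _)

theorem rmul_tmul (b b' a a' : A) : S.rmul b b' (S.tmul a a') = S.tmul (a * b) (a' * b') := rfl

theorem rmul_rmul (b b' c c' : A) (z : S.Tensor) :
    S.rmul c c' (S.rmul b b' z) = S.rmul (b * c) (b' * c') z := by
  induction z using BalTensor.induction with
  | h0 => simp
  | h1 a a' => simp only [rmul_tmul, mul_assoc]
  | h2 z w hz hw => simp only [map_add, hz, hw]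

theorem rmul_add_left (b c b' : A) (z : S.Tensor) :
    S.rmul (b + c) b' z = S.rmul b b' z + S.rmul c b' z := by
  induction z using BalTensor.induction with
  | h0 => simp
  | h1 a a' => simp only [rmul_tmul, mul_add, BalTensor.add_mk]
  | h2 z w hz hw => simp only [map_add, hz, hw]; abel

theorem rmul_add_right (b b' c' : A) (z : S.Tensor) :
    S.rmul b (b' + c') z = S.rmul b b' z + S.rmul b c' z := by
  induction z using BalTensor.induction with
  | h0 => simp
  | h1 a a' => simp only [rmul_tmul, mul_add, BalTensor.mk_add]
  | h2 z w hz hw => simp only [map_add, hz, hw]; abel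

/-- The subring `A ×_R A` of `A ⊗_R A`, as a predicate. -/
def IsTakeuchi (X : S.Tensor) : Prop :=
  ∀ r, S.rmul (S.t (MulOpposite.op r)) 1 X = S.rmul 1 (S.s r) X

/-- The product `X Y` of `X ∈ A ×_R A` and `Y ∈ A ⊗_R A`, with
`(a ⊗ a') (b ⊗ b') = a b ⊗ a' b'`. -/
def takMul (X : S.Tensor) (hX : S.IsTakeuchi X) : S.Tensor →+ S.Tensor :=
  BalTensor.lift (fun b b' => S.rmul b b' X)
    (fun b c b' => S.rmul_add_left b c b' X) (fun b b' c' => S.rmul_add_right b b' c' X)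
    (fun r b b' => by
      have h := congrArg (S.rmul b b') (hX r)
      rw [rmul_rmul, rmul_rmul, one_mul, one_mul] at h
      exact h)

/-- `(A ⊗_R A) ⊗_R A`. -/
abbrev TensorL : Type _ := BalTensor S.rActTensor S.lAct

/-- `A ⊗_R (A ⊗_R A)`. -/
abbrev TensorR : Type _ := BalTensor S.rAct S.lActTensor

/-- The associativity map `(a ⊗ b) ⊗ c ↦ a ⊗ (b ⊗ c)`. -/
def assoc : S.TensorL →+ S.TensorR :=
  BalTensor.lift
    (fun (X : S.Tensor) (c : A) =>
      (BalTensor.lift (fun a b => BalTensor.mk S.rAct S.lActTensor a (S.tmul b c))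
        (fun a a' b => BalTensor.add_mk _ _ _)
        (fun a b b' => by rw [tmul, BalTensor.add_mk, BalTensor.mk_add])
        (fun r a b => BalTensor.mk_bal _ _ _) : S.Tensor →+ S.TensorR) X)
    (fun X X' c => map_add _ _ _)
    (fun X c c' => by
      induction X using BalTensor.induction with
      | h0 => simp
      | h1 a b =>
        change BalTensor.mk S.rAct S.lActTensor a (S.tmul b (c + c')) =
          BalTensor.mk S.rAct S.lActTensor a (S.tmul b c) +
            BalTensor.mk S.rAct S.lActTensor a (S.tmul b c')
        rw [tmul, BalTensor.mk_add, BalTensor.mk_add]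
      | h2 z w hz hw => simp only [map_add, hz, hw]; abel)
    (fun r X c => by
      induction X using BalTensor.induction with
      | h0 => simp
      | h1 a b =>
        change BalTensor.mk S.rAct S.lActTensor a (S.tmul (S.rAct r b) c) =
          BalTensor.mk S.rAct S.lActTensor a (S.tmul b (S.lAct r c))
        rw [tmul, BalTensor.mk_bal]
      | h2 z w hz hw => simp only [map_add, hz, hw])

end SourceTarget

/-- A left bialgebroid `A` over `R`. -/
structure LeftBialgebroid (R A : Type*) [Ring R] [Ring A] extends SourceTarget R A where
  /-- the coproduct `Δ` -/
  comul : A →+ toSourceTarget.Tensor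
  /-- the counit `ε` -/
  counit : A →+ R
  comul_l : ∀ r a, comul (toSourceTarget.lAct r a) = toSourceTarget.lActTensor r (comul a)
  comul_r : ∀ r a, comul (toSourceTarget.rAct r a) = toSourceTarget.rActTensor r (comul a)
  counit_l : ∀ r a, counit (toSourceTarget.lAct r a) = r * counit a
  counit_r : ∀ r a, counit (toSourceTarget.rAct r a) = counit a * r
  /-- `(Δ ⊗ id) Δ = (id ⊗ Δ) Δ` -/
  coassoc : ∀ a,
    toSourceTarget.assoc
      (BalTensor.map (ρ' := toSourceTarget.rActTensor) (l' := toSourceTarget.lAct)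
        comul (AddMonoidHom.id A) comul_r (fun _ _ => rfl) (comul a)) =
    BalTensor.map (ρ' := toSourceTarget.rAct) (l' := toSourceTarget.lActTensor)
      (AddMonoidHom.id A) comul (fun _ _ => rfl) comul_l (comul a)
  /-- `(ε ⊗ id) Δ = id`, with `R ⊗_R A` identified with `A` by `r ⊗ a ↦ s(r) a` -/
  counit_comul_left : ∀ a,
    BalTensor.lift (fun b c => s (counit b) * c)
      (fun b b' c => by rw [map_add, map_add, add_mul]) (fun b c c' => mul_add _ _ _)
      (fun r b c => by
        rw [counit_r, map_mul, mul_assoc]; rfl) (comul a) = a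
  /-- `(id ⊗ ε) Δ = id`, with `A ⊗_R R` identified with `A` by `a ⊗ r ↦ t(r) a` -/
  counit_comul_right : ∀ a,
    BalTensor.lift (fun b c => t (MulOpposite.op (counit c)) * b)
      (fun b b' c => mul_add _ _ _)
      (fun b c c' => by rw [map_add, MulOpposite.op_add, map_add, add_mul])
      (fun r b c => by
        rw [counit_l, MulOpposite.op_mul, map_mul, mul_assoc]; rfl) (comul a) = a
  /-- `Δ(a) (t(r) ⊗ 1) = Δ(a) (1 ⊗ s(r))` -/
  comul_takeuchi : ∀ a, toSourceTarget.IsTakeuchi (comul a)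
  /-- `Δ(a b) = Δ(a) Δ(b)` -/
  comul_mul : ∀ a b, comul (a * b) =
    toSourceTarget.takMul (comul a) (comul_takeuchi a) (comul b)
  comul_one : comul 1 = toSourceTarget.tmul 1 1
  counit_one : counit 1 = 1
  counit_mul_s : ∀ a b, counit (a * s (counit b)) = counit (a * b)
  counit_mul_t : ∀ a b, counit (a * t (MulOpposite.op (counit b))) = counit (a * b)

theorem endAdd_apply {M : Type*} [AddCommGroup M] (f g : AddMonoid.End M) (x : M) :
    (f + g) x = f x + g x := rfl

theorem endNeg_apply {M : Type*} [AddCommGroup M] (f : AddMonoid.End M) (x : M) :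
    (-f) x = -f x := rfl

/-! ### Module algebroids and smash products -/

/-- A left `A`-module algebroid structure on the ring `M`: an `A`-module structure such that the
multiplication is defined on `M ⊗_R M`, where `r · m · r' = s(r) t(r') ▷ m`, and such that
`a ▷ (m m') = (a₍₁₎ ▷ m) (a₍₂₎ ▷ m')`, `r · 1 = 1 · r` and `a ▷ 1 = ε(a) · 1`. -/
structure LeftModuleAlgebroid {R A : Type*} [Ring R] [Ring A] (𝒜 : LeftBialgebroid R A)
    (M : Type*) [Ring M] where
  /-- the action `a ▷ m` -/
  act : A →+* AddMonoid.End M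
  mul_bal : ∀ r m m', act (𝒜.t (MulOpposite.op r)) m * m' = m * act (𝒜.s r) m'
  act_mul : ∀ a m m', act a (m * m') =
    BalTensor.lift (fun b c => act b m * act c m')
      (fun b b' c => by rw [map_add, endAdd_apply, add_mul])
      (fun b c c' => by rw [map_add, endAdd_apply, mul_add])
      (fun r b c => by
        change act (_ * _) _ * _ = _ * act (_ * _) _
        rw [map_mul, map_mul]
        exact mul_bal r _ _) (𝒜.comul a)
  act_one_bal : ∀ r, act (𝒜.s r) 1 = act (𝒜.t (MulOpposite.op r)) 1
  act_one : ∀ a, act a 1 = act (𝒜.s (𝒜.counit a)) 1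

namespace LeftModuleAlgebroid

variable {R A M : Type*} [Ring R] [Ring A] [Ring M] {𝒜 : LeftBialgebroid R A}
  (𝓜 : LeftModuleAlgebroid 𝒜 M)

/-- The map `j : R → M`, `r ↦ s(r) ▷ 1`. -/
def j (r : R) : M := 𝓜.act (𝒜.s r) 1

/-- The right action `m · r = m j(r)` of `R` on `M`. -/
def rAct (r : R) : AddMonoid.End M := AddMonoidHom.mulRight (𝓜.j r)

theorem act_mul_apply (a b : A) (m : M) : 𝓜.act (a * b) m = 𝓜.act a (𝓜.act b m) := by
  rw [map_mul]; rfl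

theorem act_t (r : R) (m : M) : 𝓜.act (𝒜.t (MulOpposite.op r)) m = m * 𝓜.j r := by
  have h := 𝓜.mul_bal r m 1
  rwa [mul_one] at h

theorem j_mul (r : R) (m : M) : 𝓜.j r * m = 𝓜.act (𝒜.s r) m := by
  have h := 𝓜.mul_bal r 1 m
  rwa [one_mul, ← 𝓜.act_one_bal] at h

/-- The underlying additive group `M ⊗_R A` of the smash product `M ⋊ A`. -/
def Smash : Type _ := BalTensor 𝓜.rAct 𝒜.lAct

namespace Smash

instance : AddCommGroup 𝓜.Smash := inferInstanceAs (AddCommGroup (BalTensor 𝓜.rAct 𝒜.lAct))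

/-- The element `m ⋊ a`. -/
def mk (m : M) (a : A) : 𝓜.Smash := BalTensor.mk 𝓜.rAct 𝒜.lAct m a

variable {𝓜}

theorem mk_bal (r : R) (m : M) (a : A) : mk 𝓜 (m * 𝓜.j r) a = mk 𝓜 m (𝒜.s r * a) :=
  BalTensor.mk_bal (ρ := 𝓜.rAct) (l := 𝒜.lAct) r m a

theorem add_mk (m m' : M) (a : A) : mk 𝓜 (m + m') a = mk 𝓜 m a + mk 𝓜 m' a :=
  BalTensor.add_mk _ _ _

theorem mk_add (m : M) (a a' : A) : mk 𝓜 m (a + a') = mk 𝓜 m a + mk 𝓜 m a' :=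
  BalTensor.mk_add _ _ _

theorem induction {p : 𝓜.Smash → Prop} (z : 𝓜.Smash) (h0 : p 0)
    (h1 : ∀ m a, p (mk 𝓜 m a)) (h2 : ∀ z w, p z → p w → p (z + w)) : p z :=
  BalTensor.induction (ρ := 𝓜.rAct) (l := 𝒜.lAct) z h0 h1 h2

variable (𝓜) in
/-- The map `A ⊗_R A → M ⋊ A`, `b ⊗ c ↦ m (b ▷ m') ⋊ c a'`. -/
def mulAux (m m' : M) (a' : A) : 𝒜.Tensor →+ 𝓜.Smash :=
  BalTensor.lift (fun b c => mk 𝓜 (m * 𝓜.act b m') (c * a'))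
    (fun b b' c => by rw [map_add, endAdd_apply, mul_add, add_mk])
    (fun b c c' => by rw [add_mul, mk_add])
    (fun r b c => by
      change mk 𝓜 (m * 𝓜.act (_ * _) m') (c * a') = mk 𝓜 _ (𝒜.s r * c * a')
      rw [act_mul_apply, act_t, ← mul_assoc, mk_bal, mul_assoc])

theorem mulAux_tmul (m m' : M) (a' b c : A) :
    mulAux 𝓜 m m' a' (𝒜.tmul b c) = mk 𝓜 (m * 𝓜.act b m') (c * a') := rfl

theorem mulAux_add_left (m n m' : M) (a' : A) (z : 𝒜.Tensor) :
    mulAux 𝓜 (m + n) m' a' z = mulAux 𝓜 m m' a' z + mulAux 𝓜 n m' a' z := by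
  induction z using BalTensor.induction with
  | h0 => simp
  | h1 b c => simp only [mulAux_tmul, add_mul, add_mk]
  | h2 z w hz hw => simp only [map_add, hz, hw]; abel

theorem mulAux_add_mid (m m' n' : M) (a' : A) (z : 𝒜.Tensor) :
    mulAux 𝓜 m (m' + n') a' z = mulAux 𝓜 m m' a' z + mulAux 𝓜 m n' a' z := by
  induction z using BalTensor.induction with
  | h0 => simp
  | h1 b c => simp only [mulAux_tmul, map_add, mul_add, add_mk]
  | h2 z w hz hw => simp only [map_add, hz, hw]; abel

theorem mulAux_add_right (m m' : M) (a' c' : A) (z : 𝒜.Tensor) :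
    mulAux 𝓜 m m' (a' + c') z = mulAux 𝓜 m m' a' z + mulAux 𝓜 m m' c' z := by
  induction z using BalTensor.induction with
  | h0 => simp
  | h1 b c => simp only [mulAux_tmul, mul_add, mk_add]
  | h2 z w hz hw => simp only [map_add, hz, hw]; abel

theorem mulAux_rmul (m m' : M) (a' b c : A) (z : 𝒜.Tensor) :
    mulAux 𝓜 m m' a' (𝒜.rmul b c z) = mulAux 𝓜 m (𝓜.act b m') (c * a') z := by
  induction z using BalTensor.induction with
  | h0 => simp
  | h1 d e => simp only [SourceTarget.rmul_tmul, mulAux_tmul, act_mul_apply, mul_assoc]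
  | h2 z w hz hw => simp only [map_add, hz, hw]

theorem mulAux_lAct (r : R) (m m' : M) (a' : A) (z : 𝒜.Tensor) :
    mulAux 𝓜 m m' a' (𝒜.lActTensor r z) = mulAux 𝓜 (m * 𝓜.j r) m' a' z := by
  induction z using BalTensor.induction with
  | h0 => simp
  | h1 b c =>
    change mk 𝓜 (m * 𝓜.act (𝒜.s r * b) m') (c * a') = mk 𝓜 (m * 𝓜.j r * 𝓜.act b m') (c * a')
    rw [act_mul_apply, ← j_mul, mul_assoc]
  | h2 z w hz hw => simp only [map_add, hz, hw]

/-- Right multiplication by `m' ⋊ a'`. -/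
def mulRightMk (m' : M) (a' : A) : 𝓜.Smash →+ 𝓜.Smash :=
  BalTensor.lift (ρ := 𝓜.rAct) (l := 𝒜.lAct) (fun m a => mulAux 𝓜 m m' a' (𝒜.comul a))
    (fun m n a => mulAux_add_left m n m' a' _) (fun m a b => by rw [map_add, map_add])
    (fun r m a => by rw [𝒜.comul_l, mulAux_lAct]; rfl)

theorem mulRightMk_mk (m m' : M) (a a' : A) :
    mulRightMk m' a' (mk 𝓜 m a) = mulAux 𝓜 m m' a' (𝒜.comul a) := rfl

/-- Left multiplication by `z`. -/
def mulLeft (z : 𝓜.Smash) : 𝓜.Smash →+ 𝓜.Smash :=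
  BalTensor.lift (ρ := 𝓜.rAct) (l := 𝒜.lAct) (fun m' a' => mulRightMk m' a' z)
    (fun m' n' a' => by
      induction z using Smash.induction with
      | h0 => simp
      | h1 m a => simp only [mulRightMk_mk, mulAux_add_mid]
      | h2 z w hz hw => simp only [map_add, hz, hw]; abel)
    (fun m' a' c' => by
      induction z using Smash.induction with
      | h0 => simp
      | h1 m a => simp only [mulRightMk_mk, mulAux_add_right]
      | h2 z w hz hw => simp only [map_add, hz, hw]; abel)
    (fun r m' a' => by
      induction z using Smash.induction with
      | h0 => simp
      | h1 m a =>
        change mulAux 𝓜 m (m' * 𝓜.j r) a' (𝒜.comul a) =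
          mulAux 𝓜 m m' (𝒜.s r * a') (𝒜.comul a)
        have h := congrArg (mulAux 𝓜 m m' a') (𝒜.comul_takeuchi a r)
        rw [mulAux_rmul, mulAux_rmul, act_t, one_mul, map_one] at h
        exact h
      | h2 z w hz hw => simp only [map_add, hz, hw])

/-- The multiplication `(m ⋊ a) (m' ⋊ a') = m (a₍₁₎ ▷ m') ⋊ a₍₂₎ a'`. -/
instance : Mul 𝓜.Smash := ⟨fun z w => mulLeft z w⟩

/-- The unit `1 ⋊ 1`. -/
instance : One 𝓜.Smash := ⟨mk 𝓜 1 1⟩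

theorem one_def : (1 : 𝓜.Smash) = mk 𝓜 1 1 := rfl

theorem mk_mul_mk (m m' : M) (a a' : A) :
    mk 𝓜 m a * mk 𝓜 m' a' = mulAux 𝓜 m m' a' (𝒜.comul a) := rfl

protected theorem mul_add' (z w w' : 𝓜.Smash) : z * (w + w') = z * w + z * w' :=
  map_add (mulLeft z) w w'

protected theorem add_mul' (z z' w : 𝓜.Smash) : (z + z') * w = z * w + z' * w := by
  induction w using Smash.induction with
  | h0 => change mulLeft _ 0 = mulLeft _ 0 + mulLeft _ 0; simp
  | h1 m a => exact map_add (mulRightMk m a) z z'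
  | h2 v w hv hw => simp only [Smash.mul_add', hv, hw]; abel

protected theorem zero_mul' (z : 𝓜.Smash) : 0 * z = 0 := by
  have h := Smash.add_mul' 0 0 z
  rw [add_zero] at h
  exact left_eq_add.1 h

protected theorem mul_zero' (z : 𝓜.Smash) : z * 0 = 0 := map_zero (mulLeft z)

/-- The map `A ⊗_R (A ⊗_R A) → M ⋊ A`, `b ⊗ (c ⊗ d) ↦ m (b ▷ p) (c ▷ q) ⋊ d a`. -/
def mulAux₃ (m p q : M) (a : A) : 𝒜.TensorR →+ 𝓜.Smash :=
  BalTensor.lift (fun b z => mulAux 𝓜 (m * 𝓜.act b p) q a z)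
    (fun b b' z => by rw [map_add, endAdd_apply, mul_add, mulAux_add_left])
    (fun b z z' => map_add _ _ _)
    (fun r b z => by
      change mulAux 𝓜 (m * 𝓜.act (_ * b) p) q a z = _
      rw [act_mul_apply, act_t, ← mul_assoc, mulAux_lAct])

/-- The map `A ⊗_R A → M ⋊ A`, `b ⊗ c ↦ m (b ▷ p) (c₍₁₎ ▷ q) ⋊ c₍₂₎ a`. -/
def mulAux₂ (m p q : M) (a : A) : 𝒜.Tensor →+ 𝓜.Smash :=
  (mulAux₃ m p q a).comp
    (BalTensor.map (ρ' := 𝒜.rAct) (l' := 𝒜.lActTensor)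
      (AddMonoidHom.id A) 𝒜.comul (fun _ _ => rfl) 𝒜.comul_l)

theorem mulAux₂_tmul (m p q : M) (a b c : A) :
    mulAux₂ (𝓜 := 𝓜) m p q a (𝒜.tmul b c) =
      mulAux 𝓜 (m * 𝓜.act b p) q a (𝒜.comul c) := rfl

theorem mulAux₂_comul (m p q : M) (a b : A) :
    mulAux₂ m p q a (𝒜.comul b) = mulAux 𝓜 m (p * q) a (𝒜.comul b) := by
  rw [mulAux₂, AddMonoidHom.comp_apply, ← 𝒜.coassoc]
  generalize 𝒜.comul b = z
  induction z using BalTensor.induction with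
  | h0 => simp
  | h1 c d =>
    rw [BalTensor.map_mk, AddMonoidHom.id_apply]
    change _ = mk 𝓜 (m * 𝓜.act c (p * q)) (d * a)
    rw [𝓜.act_mul c p q]
    generalize 𝒜.comul c = w
    induction w using BalTensor.induction with
    | h0 =>
      have h : BalTensor.mk 𝒜.rActTensor 𝒜.lAct 0 d = 0 := by
        simpa using BalTensor.add_mk (ρ := 𝒜.rActTensor) (l := 𝒜.lAct) 0 0 d
      have h' : mk 𝓜 0 (d * a) = 0 := by
        simpa using add_mk (𝓜 := 𝓜) 0 0 (d * a)
      rw [h, map_zero, map_zero, map_zero, mul_zero, h']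
    | h1 e f =>
      change mk 𝓜 (m * 𝓜.act e p * 𝓜.act f q) (d * a) =
        mk 𝓜 (m * (𝓜.act e p * 𝓜.act f q)) (d * a)
      rw [mul_assoc]
    | h2 v w hv hw => rw [BalTensor.add_mk, map_add, map_add, hv, hw, map_add, mul_add, add_mk]
  | h2 z w hz hw => simp only [map_add, hz, hw]

protected theorem mul_assoc' (x y z : 𝓜.Smash) : x * y * z = x * (y * z) := by
  induction x using Smash.induction with
  | h0 => simp only [Smash.zero_mul']
  | h2 x x' hx hx' => simp only [Smash.add_mul', hx, hx']
  | h1 m a =>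
  induction y using Smash.induction with
  | h0 => simp only [Smash.zero_mul', Smash.mul_zero']
  | h2 y y' hy hy' => simp only [Smash.add_mul', Smash.mul_add', hy, hy']
  | h1 m' a' =>
  induction z using Smash.induction with
  | h0 => simp only [Smash.mul_zero']
  | h2 z z' hz hz' => simp only [Smash.mul_add', hz, hz']
  | h1 m'' a'' =>
  obtain ⟨n, b, c, h⟩ := BalTensor.exists_sum (𝒜.comul a')
  have key : ∀ X : 𝒜.Tensor, mulAux 𝓜 m m' a' X * mk 𝓜 m'' a'' =
      ∑ i, mulAux₂ m m' (𝓜.act (b i) m'') (c i * a'') X := by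
    intro X
    induction X using BalTensor.induction with
    | h0 => simp only [map_zero, Smash.zero_mul', Finset.sum_const_zero]
    | h2 z w hz hw => simp only [map_add, Smash.add_mul', hz, hw, Finset.sum_add_distrib]
    | h1 d e =>
      rw [mulAux_tmul, mk_mul_mk, 𝒜.comul_mul, h, map_sum, map_sum]
      refine Finset.sum_congr rfl fun i _ => ?_
      rw [mulAux₂_tmul, ← mulAux_rmul]
      rfl
  rw [mk_mul_mk, key, mk_mul_mk, h, map_sum]
  change _ = mulLeft _ _
  rw [map_sum]
  refine Finset.sum_congr rfl fun i _ => ?_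
  rw [mulAux₂_comul]
  rfl

protected theorem one_mul' (x : 𝓜.Smash) : 1 * x = x := by
  induction x using Smash.induction with
  | h0 => simp only [Smash.mul_zero']
  | h2 x x' hx hx' => simp only [Smash.mul_add', hx, hx']
  | h1 m a => rw [one_def, mk_mul_mk, 𝒜.comul_one, mulAux_tmul, map_one, one_mul, one_mul]; rfl

protected theorem mul_one' (x : 𝓜.Smash) : x * 1 = x := by
  induction x using Smash.induction with
  | h0 => simp only [Smash.zero_mul']
  | h2 x x' hx hx' => simp only [Smash.add_mul', hx, hx']
  | h1 m a =>
    rw [one_def, mk_mul_mk]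
    conv_rhs => rw [← 𝒜.counit_comul_left a]
    generalize 𝒜.comul a = z
    induction z using BalTensor.induction with
    | h0 =>
      have h : mk 𝓜 m 0 = 0 := by simpa using mk_add (𝓜 := 𝓜) m 0 0
      rw [map_zero, map_zero, h]
    | h1 b c =>
      change mk 𝓜 (m * 𝓜.act b 1) (c * 1) = mk 𝓜 m (𝒜.s (𝒜.counit b) * c)
      rw [𝓜.act_one, mul_one]
      exact mk_bal _ _ _
    | h2 z w hz hw => rw [map_add, map_add, hz, hw, mk_add]

/-- The smash product ring `M ⋊ A`. -/
instance : Ring 𝓜.Smash :=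
  { (inferInstance : AddCommGroup 𝓜.Smash) with
    mul := (· * ·)
    one := 1
    left_distrib := Smash.mul_add'
    right_distrib := Smash.add_mul'
    zero_mul := Smash.zero_mul'
    mul_zero := Smash.mul_zero'
    mul_assoc := Smash.mul_assoc'
    one_mul := Smash.one_mul'
    mul_one := Smash.mul_one' }

end Smash

end LeftModuleAlgebroid

/-! ### Ring extensions

A ring extension `M | N` is a ring homomorphism `ι : N → M`. -/

section Extension

variable {N M : Type*} [Ring N] [Ring M] (ι : N →+* M)

/-- The endomorphism ring `End M_N` of the right `N`-module `M`. -/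
def endRight : Subring (AddMonoid.End M) where
  carrier := {f | ∀ x n, f (x * ι n) = f x * ι n}
  mul_mem' {f g} hf hg x n := by
    change f (g (x * ι n)) = f (g x) * ι n
    rw [hg, hf]
  one_mem' _ _ := rfl
  add_mem' {f g} hf hg x n := by
    rw [endAdd_apply, endAdd_apply, hf, hg, add_mul]
  zero_mem' _ _ := (zero_mul _).symm
  neg_mem' {f} hf x n := by
    rw [endNeg_apply, endNeg_apply, hf, neg_mul]

/-- The endomorphism ring `A = End _N M_N` of the `N`-`N`-bimodule `M`. -/
def endBimod : Subring (AddMonoid.End M) where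
  carrier := {f | (∀ n x, f (ι n * x) = ι n * f x) ∧ ∀ x n, f (x * ι n) = f x * ι n}
  mul_mem' {f g} hf hg := by
    refine ⟨fun n x => ?_, fun x n => ?_⟩
    · change f (g (ι n * x)) = ι n * f (g x)
      rw [hg.1, hf.1]
    · change f (g (x * ι n)) = f (g x) * ι n
      rw [hg.2, hf.2]
  one_mem' := ⟨fun _ _ => rfl, fun _ _ => rfl⟩
  add_mem' {f g} hf hg := by
    refine ⟨fun n x => ?_, fun x n => ?_⟩
    · rw [endAdd_apply, endAdd_apply, hf.1, hg.1, mul_add]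
    · rw [endAdd_apply, endAdd_apply, hf.2, hg.2, add_mul]
  zero_mem' := ⟨fun _ _ => (mul_zero _).symm, fun _ _ => (zero_mul _).symm⟩
  neg_mem' {f} hf := by
    refine ⟨fun n x => ?_, fun x n => ?_⟩
    · rw [endNeg_apply, endNeg_apply, hf.1, mul_neg]
    · rw [endNeg_apply, endNeg_apply, hf.2, neg_mul]

/-- The centralizer `R = C_M(N)`. -/
abbrev centralizerRing : Subring M := Subring.centralizer (Set.range ι)

/-- The right action `m · n = m ι(n)` of `N` on `M`. -/
def extRAct (n : N) : AddMonoid.End M := AddMonoidHom.mulRight (ι n)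

/-- The left action `n · m = ι(n) m` of `N` on `M`. -/
def extLAct (n : N) : AddMonoid.End M := AddMonoidHom.mulLeft (ι n)

/-- The tensor square `M ⊗_N M`. -/
abbrev TensorSq : Type _ := BalTensor (extRAct ι) (extLAct ι)

namespace TensorSq

/-- The elementary tensor `x ⊗ y`. -/
abbrev tmul (x y : M) : TensorSq ι := BalTensor.mk (extRAct ι) (extLAct ι) x y

/-- The left action `m · (x ⊗ y) = m x ⊗ y`. -/
def lmul (m : M) : TensorSq ι →+ TensorSq ι :=
  BalTensor.map (AddMonoidHom.mulLeft m) (AddMonoidHom.id M)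
    (fun _ _ => (mul_assoc _ _ _).symm) (fun _ _ => rfl)

/-- The right action `(x ⊗ y) · m = x ⊗ y m`. -/
def rmul (m : M) : TensorSq ι →+ TensorSq ι :=
  BalTensor.map (AddMonoidHom.id M) (AddMonoidHom.mulRight m)
    (fun _ _ => rfl) (fun _ _ => mul_assoc _ _ _)

/-- The group `B = (M ⊗_N M)^N`. -/
def centralizer : AddSubgroup (TensorSq ι) where
  carrier := {b | ∀ n, lmul ι (ι n) b = rmul ι (ι n) b}
  add_mem' {b c} hb hc n := by rw [map_add, map_add, hb, hc]
  zero_mem' n := by rw [map_zero, map_zero]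
  neg_mem' {b} hb n := by rw [map_neg, map_neg, hb]

end TensorSq

/-- `M | N` is left depth two: for some `k > 0`, the `N`-`M`-bimodule `M ⊗_N M` is isomorphic to a
direct summand of `M^k`, that is, there are `N`-`M`-bimodule maps `f : M ⊗_N M → M^k` and
`g : M^k → M ⊗_N M` with `g ∘ f = id`. -/
def IsLeftD2 : Prop :=
  ∃ k : ℕ, 0 < k ∧ ∃ (f : TensorSq ι →+ (Fin k → M)) (g : (Fin k → M) →+ TensorSq ι),
    (∀ n z, f (TensorSq.lmul ι (ι n) z) = fun i => ι n * f z i) ∧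
    (∀ z m, f (TensorSq.rmul ι m z) = fun i => f z i * m) ∧
    (∀ n v, g (fun i => ι n * v i) = TensorSq.lmul ι (ι n) (g v)) ∧
    (∀ v m, g (fun i => v i * m) = TensorSq.rmul ι m (g v)) ∧
    ∀ z, g (f z) = z

/-- `(b, β)` is a left D2 quasibasis: `∑ bᵢ¹ ⊗ bᵢ² βᵢ(m) = m ⊗ 1`. -/
def IsLeftQuasibasis {k : ℕ} (b : Fin k → TensorSq.centralizer ι) (β : Fin k → endBimod ι) :
    Prop :=
  ∀ m, ∑ i, TensorSq.rmul ι ((β i : AddMonoid.End M) m) (b i : TensorSq ι) = TensorSq.tmul ι m 1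

/-- `(c, γ)` is a right D2 quasibasis: `∑ γᵢ(m) cᵢ¹ ⊗ cᵢ² = 1 ⊗ m`. -/
def IsRightQuasibasis {k : ℕ} (c : Fin k → TensorSq.centralizer ι) (γ : Fin k → endBimod ι) :
    Prop :=
  ∀ m, ∑ i, TensorSq.lmul ι ((γ i : AddMonoid.End M) m) (c i : TensorSq ι) = TensorSq.tmul ι 1 m

variable {ι}

/-- The map `b¹ ⊗ b² ↦ α(b¹) b²`. -/
def evalLeft (α : endBimod ι) : TensorSq ι →+ M :=
  BalTensor.lift (fun x y => (α : AddMonoid.End M) x * y)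
    (fun x x' y => by rw [map_add, add_mul]) (fun x y y' => mul_add _ _ _)
    (fun n x y => by
      change (α : AddMonoid.End M) (x * ι n) * y = (α : AddMonoid.End M) x * (ι n * y)
      rw [α.2.2, mul_assoc])

/-- The map `b¹ ⊗ b² ↦ b¹ α(b²)`. -/
def evalRight (α : endBimod ι) : TensorSq ι →+ M :=
  BalTensor.lift (fun x y => x * (α : AddMonoid.End M) y)
    (fun x x' y => add_mul _ _ _) (fun x y y' => by rw [map_add, mul_add])
    (fun n x y => by
      change x * ι n * (α : AddMonoid.End M) y = x * (α : AddMonoid.End M) (ι n * y)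
      rw [α.2.1, mul_assoc])

/-- For `α ∈ A` and `b ∈ B`, the element `m ↦ α(m b¹) b²` of `A`. -/
def coeffLeft (α : endBimod ι) (b : TensorSq.centralizer ι) : endBimod ι :=
  ⟨AddMonoidHom.mk' (fun m => evalLeft α (TensorSq.lmul ι m b)) (fun m m' => by
      rw [← map_add]
      generalize (b : TensorSq ι) = z
      congr 1
      induction z using BalTensor.induction with
      | h0 => simp
      | h1 x y =>
        change TensorSq.tmul ι ((m + m') * x) y =
          TensorSq.tmul ι (m * x) y + TensorSq.tmul ι (m' * x) y
        rw [add_mul, TensorSq.tmul, BalTensor.add_mk]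
      | h2 z w hz hw => simp only [map_add, hz, hw]; abel), by
    refine ⟨fun n m => ?_, fun m n => ?_⟩
    · change evalLeft α (TensorSq.lmul ι (ι n * m) b) = ι n * evalLeft α (TensorSq.lmul ι m b)
      generalize (b : TensorSq ι) = z
      induction z using BalTensor.induction with
      | h0 => simp
      | h1 x y =>
        change (α : AddMonoid.End M) (ι n * m * x) * y =
          ι n * ((α : AddMonoid.End M) (m * x) * y)
        rw [mul_assoc, α.2.1, mul_assoc]
      | h2 z w hz hw => simp only [map_add, hz, hw, mul_add]
    · change evalLeft α (TensorSq.lmul ι (m * ι n) b) = evalLeft α (TensorSq.lmul ι m b) * ι n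
      have h : TensorSq.lmul ι (m * ι n) b = TensorSq.lmul ι m (TensorSq.rmul ι (ι n) b) := by
        rw [← b.2 n]
        generalize (b : TensorSq ι) = z
        induction z using BalTensor.induction with
        | h0 => simp
        | h1 x y =>
          change TensorSq.tmul ι (m * ι n * x) y = TensorSq.tmul ι (m * (ι n * x)) y
          rw [mul_assoc]
        | h2 z w hz hw => simp only [map_add, hz, hw]
      rw [h]
      generalize (b : TensorSq ι) = z
      induction z using BalTensor.induction with
      | h0 => simp
      | h1 x y => exact (mul_assoc _ _ _).symm
      | h2 z w hz hw => simp only [map_add, hz, hw, add_mul]⟩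

/-- For `α ∈ A` and `c ∈ B`, the element `m ↦ c¹ α(c² m)` of `A`. -/
def coeffRight (c : TensorSq.centralizer ι) (α : endBimod ι) : endBimod ι :=
  ⟨AddMonoidHom.mk' (fun m => evalRight α (TensorSq.rmul ι m c)) (fun m m' => by
      rw [← map_add]
      generalize (c : TensorSq ι) = z
      congr 1
      induction z using BalTensor.induction with
      | h0 => simp
      | h1 x y =>
        change TensorSq.tmul ι x (y * (m + m')) =
          TensorSq.tmul ι x (y * m) + TensorSq.tmul ι x (y * m')
        rw [mul_add, TensorSq.tmul, BalTensor.mk_add]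
      | h2 z w hz hw => simp only [map_add, hz, hw]; abel), by
    refine ⟨fun n m => ?_, fun m n => ?_⟩
    · change evalRight α (TensorSq.rmul ι (ι n * m) c) = ι n * evalRight α (TensorSq.rmul ι m c)
      have h : TensorSq.rmul ι (ι n * m) c = TensorSq.rmul ι m (TensorSq.lmul ι (ι n) c) := by
        rw [c.2 n]
        generalize (c : TensorSq ι) = z
        induction z using BalTensor.induction with
        | h0 => simp
        | h1 x y =>
          change TensorSq.tmul ι x (y * (ι n * m)) = TensorSq.tmul ι x (y * ι n * m)
          rw [mul_assoc]
        | h2 z w hz hw => simp only [map_add, hz, hw]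
      rw [h]
      generalize (c : TensorSq ι) = z
      induction z using BalTensor.induction with
      | h0 => simp
      | h1 x y => exact mul_assoc _ _ _
      | h2 z w hz hw => simp only [map_add, hz, hw, mul_add]
    · change evalRight α (TensorSq.rmul ι (m * ι n) c) = evalRight α (TensorSq.rmul ι m c) * ι n
      generalize (c : TensorSq ι) = z
      induction z using BalTensor.induction with
      | h0 => simp
      | h1 x y =>
        change x * (α : AddMonoid.End M) (y * (m * ι n)) =
          x * (α : AddMonoid.End M) (y * m) * ι n
        rw [← mul_assoc, α.2.2, mul_assoc]
      | h2 z w hz hw => simp only [map_add, hz, hw, add_mul]⟩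

end Extension

/-! ### Frobenius extensions and the basic construction -/

/-- A Frobenius structure on `M | N`: an `N`-`N`-bimodule map `E : M → N` and dual bases
`xᵢ, yᵢ ∈ M` with `∑ xᵢ E(yᵢ m) = m = ∑ E(m xᵢ) yᵢ`. -/
structure FrobeniusSystem {N M : Type*} [Ring N] [Ring M] (ι : N →+* M) where
  E : M →+ N
  E_left : ∀ n m, E (ι n * m) = n * E m
  E_right : ∀ m n, E (m * ι n) = E m * n
  k : ℕ
  x : Fin k → M
  y : Fin k → M
  sum_left : ∀ m, ∑ i, x i * ι (E (y i * m)) = m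
  sum_right : ∀ m, ∑ i, ι (E (m * x i)) * y i = m

namespace FrobeniusSystem

variable {N M : Type*} [Ring N] [Ring M] {ι : N →+* M} (F : FrobeniusSystem ι)

/-- The underlying additive group `M ⊗_N M` of the basic construction `M₁`. -/
def BasicConstruction (_F : FrobeniusSystem ι) : Type _ := TensorSq ι

namespace BasicConstruction

instance : AddCommGroup F.BasicConstruction := inferInstanceAs (AddCommGroup (TensorSq ι))

/-- The element `x ⊗ y = x e₁ y` of `M₁`. -/
def mk (x y : M) : F.BasicConstruction := TensorSq.tmul ι x y

variable {F}

theorem mk_bal (n : N) (x y : M) : mk F (x * ι n) y = mk F x (ι n * y) :=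
  BalTensor.mk_bal (ρ := extRAct ι)
    (l := extLAct ι) n x y

theorem add_mk (x x' y : M) : mk F (x + x') y = mk F x y + mk F x' y :=
  BalTensor.add_mk _ _ _

theorem mk_add (x y y' : M) : mk F x (y + y') = mk F x y + mk F x y' :=
  BalTensor.mk_add _ _ _

theorem induction {p : F.BasicConstruction → Prop} (z : F.BasicConstruction) (h0 : p 0)
    (h1 : ∀ x y, p (mk F x y)) (h2 : ∀ z w, p z → p w → p (z + w)) : p z :=
  BalTensor.induction (ρ := extRAct ι)
    (l := extLAct ι) z h0 h1 h2

/-- Right multiplication `m ⊗ m' ↦ m E(m' x) ⊗ y` by `x ⊗ y`. -/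
def mulRightMk (x y : M) : F.BasicConstruction →+ F.BasicConstruction :=
  BalTensor.lift (ρ := extRAct ι)
    (l := extLAct ι) (fun m m' => mk F (m * ι (F.E (m' * x))) y)
    (fun m n m' => by rw [add_mul, add_mk])
    (fun m m' n' => by rw [add_mul, map_add, map_add, mul_add, add_mk])
    (fun n m m' => by
      change mk F (m * ι n * ι (F.E (m' * x))) y = mk F (m * ι (F.E (ι n * m' * x))) y
      rw [mul_assoc (ι n), F.E_left, map_mul ι, mul_assoc])

theorem mulRightMk_mk (x y m m' : M) :
    mulRightMk x y (mk F m m') = mk F (m * ι (F.E (m' * x))) y := rfl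

/-- Left multiplication by `z`. -/
def mulLeft (z : F.BasicConstruction) : F.BasicConstruction →+ F.BasicConstruction :=
  BalTensor.lift (ρ := extRAct ι)
    (l := extLAct ι) (fun x y => mulRightMk x y z)
    (fun x x' y => by
      induction z using BasicConstruction.induction with
      | h0 => simp
      | h1 m m' => simp only [mulRightMk_mk, mul_add, map_add, add_mk]
      | h2 z w hz hw => simp only [map_add, hz, hw]; abel)
    (fun x y y' => by
      induction z using BasicConstruction.induction with
      | h0 => simp
      | h1 m m' => simp only [mulRightMk_mk, mk_add]
      | h2 z w hz hw => simp only [map_add, hz, hw]; abel)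
    (fun n x y => by
      induction z using BasicConstruction.induction with
      | h0 => simp
      | h1 m m' =>
        change mk F (m * ι (F.E (m' * (x * ι n)))) y = mk F (m * ι (F.E (m' * x))) (ι n * y)
        rw [← mul_assoc m', F.E_right, map_mul ι, ← mul_assoc m, mk_bal]
      | h2 z w hz hw => simp only [map_add, hz, hw])

/-- The `E`-multiplication `(m ⊗ m') (x ⊗ y) = m E(m' x) ⊗ y`. -/
instance : Mul F.BasicConstruction := ⟨fun z w => mulLeft z w⟩

/-- The unit `∑ xᵢ ⊗ yᵢ`. -/
instance : One F.BasicConstruction := ⟨∑ i, mk F (F.x i) (F.y i)⟩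

theorem one_def : (1 : F.BasicConstruction) = ∑ i, mk F (F.x i) (F.y i) := rfl

theorem mk_mul_mk (m m' x y : M) : mk F m m' * mk F x y = mk F (m * ι (F.E (m' * x))) y := rfl

protected theorem mul_add' (z w w' : F.BasicConstruction) : z * (w + w') = z * w + z * w' :=
  map_add (mulLeft z) w w'

protected theorem mul_zero' (z : F.BasicConstruction) : z * 0 = 0 := map_zero (mulLeft z)

protected theorem add_mul' (z z' w : F.BasicConstruction) : (z + z') * w = z * w + z' * w := by
  induction w using BasicConstruction.induction with
  | h0 => simp only [BasicConstruction.mul_zero', add_zero]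
  | h1 x y => exact map_add (mulRightMk x y) z z'
  | h2 v w hv hw => simp only [BasicConstruction.mul_add', hv, hw]; abel

protected theorem zero_mul' (z : F.BasicConstruction) : 0 * z = 0 := by
  have h := BasicConstruction.add_mul' 0 0 z
  rw [add_zero] at h
  exact left_eq_add.1 h

protected theorem mul_assoc' (u v w : F.BasicConstruction) : u * v * w = u * (v * w) := by
  induction u using BasicConstruction.induction with
  | h0 => simp only [BasicConstruction.zero_mul']
  | h2 x x' hx hx' => simp only [BasicConstruction.add_mul', hx, hx']
  | h1 m m' =>
  induction v using BasicConstruction.induction with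
  | h0 => simp only [BasicConstruction.zero_mul', BasicConstruction.mul_zero']
  | h2 y y' hy hy' =>
    simp only [BasicConstruction.add_mul', BasicConstruction.mul_add', hy, hy']
  | h1 p p' =>
  induction w using BasicConstruction.induction with
  | h0 => simp only [BasicConstruction.mul_zero']
  | h2 z z' hz hz' => simp only [BasicConstruction.mul_add', hz, hz']
  | h1 q q' =>
    rw [mk_mul_mk, mk_mul_mk, mk_mul_mk, mk_mul_mk, ← mul_assoc m' p, F.E_right, map_mul ι,
      mul_assoc]

protected theorem one_mul' (u : F.BasicConstruction) : 1 * u = u := by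
  induction u using BasicConstruction.induction with
  | h0 => simp only [BasicConstruction.mul_zero']
  | h2 x x' hx hx' => simp only [BasicConstruction.mul_add', hx, hx']
  | h1 m m' =>
    change mulRightMk (F := F) m m' 1 = mk F m m'
    rw [one_def, map_sum]
    conv_rhs => rw [← F.sum_left m]
    exact (map_sum (AddMonoidHom.mk' (fun x => mk F x m') (fun x x' => add_mk x x' m'))
      (fun i => F.x i * ι (F.E (F.y i * m))) Finset.univ).symm

protected theorem mul_one' (u : F.BasicConstruction) : u * 1 = u := by
  induction u using BasicConstruction.induction with
  | h0 => simp only [BasicConstruction.zero_mul']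
  | h2 x x' hx hx' => simp only [BasicConstruction.add_mul', hx, hx']
  | h1 m m' =>
    change mulLeft (mk F m m') 1 = mk F m m'
    rw [one_def, map_sum]
    change ∑ i, mk F (m * ι (F.E (m' * F.x i))) (F.y i) = _
    simp only [mk_bal]
    conv_rhs => rw [← F.sum_right m']
    exact (map_sum (AddMonoidHom.mk' (fun y => mk F m y) (fun y y' => mk_add m y y'))
      (fun i => ι (F.E (m' * F.x i)) * F.y i) Finset.univ).symm

/-- The ring `M₁ = M ⊗_N M` with the `E`-multiplication. -/
instance : Ring F.BasicConstruction :=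
  { (inferInstance : AddCommGroup F.BasicConstruction) with
    mul := (· * ·)
    one := 1
    left_distrib := BasicConstruction.mul_add'
    right_distrib := BasicConstruction.add_mul'
    zero_mul := BasicConstruction.zero_mul'
    mul_zero := BasicConstruction.mul_zero'
    mul_assoc := BasicConstruction.mul_assoc'
    one_mul := BasicConstruction.one_mul'
    mul_one := BasicConstruction.mul_one' }

end BasicConstruction

end FrobeniusSystem

section DepthTwo

variable {N M : Type*} [Ring N] [Ring M] {ι : N →+* M}

/-! Everything rests on a dual basis of A as a left R-module. Pairing α ∈ A with b ∈ B gives α(b¹)b²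
∈ R, and applying α to a left quasibasis identity gives α = ∑ λ(α(bᵢ¹)bᵢ²) ∘ βᵢ. Hence, for a right
R-module X, every tensor in X ⊗_R A is recovered from finitely many coordinates in X (`sum_coord`).

For X = A the coordinates can be computed from the values α(x)β(y), so an element of A ⊗_R A is the
same as the function of two variables on M that it induces (`evalPair_ext`); threefold tensors are
handled likewise (`evalTriple_ext`). The coproduct is the unique tensor with α₍₁₎(x) α₍₂₎(y) =
α(xy). A left quasibasis provides existence; uniqueness makes the formula independent of the
quasibasis and also yields the formula for right quasibases. After evaluation, the bialgebroid
axioms for Δ become associativity, distributivity and unit laws in M, and the product rule for the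
action on M is the characterization of Δ itself.

For X = M the coordinates of an element of M ⋊ A depend only on the endomorphism it induces
(`smashCoord_eq`), which gives injectivity of M ⋊ A → End(M_N). Surjectivity is the expansion f(m) =
∑ f(bᵢ¹)bᵢ² βᵢ(m) (`sum_mul_quasibasis`). In the Frobenius case, End(M_N) ≅ M₁ follows from the dual
bases alone, and the second isomorphism is the composite. -/

theorem BalTensor.zero_mk {R X Y : Type*} [AddCommGroup X] [AddCommGroup Y]
    {ρ : R → AddMonoid.End X} {l : R → AddMonoid.End Y} (y : Y) : BalTensor.mk ρ l 0 y = 0 :=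
  map_zero (AddMonoidHom.mk' (fun x => BalTensor.mk ρ l x y) fun x x' => BalTensor.add_mk x x' y)

theorem BalTensor.mk_sum {R X Y I : Type*} [AddCommGroup X] [AddCommGroup Y]
    {ρ : R → AddMonoid.End X} {l : R → AddMonoid.End Y} (s : Finset I) (x : X) (y : I → Y) :
    BalTensor.mk ρ l x (∑ i ∈ s, y i) = ∑ i ∈ s, BalTensor.mk ρ l x (y i) :=
  map_sum (AddMonoidHom.mk' (fun y => BalTensor.mk ρ l x y) (BalTensor.mk_add x)) y s

/-! ### Evaluation maps on M ⊗_N M and the pairing of A with B -/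

namespace TensorSq

theorem evalLeft_lmul (α : endBimod ι) (n : N) (z : TensorSq ι) :
    evalLeft α (lmul ι (ι n) z) = ι n * evalLeft α z := by
  induction z using BalTensor.induction with
  | h0 => simp
  | h1 x y =>
    change (α : AddMonoid.End M) (ι n * x) * y = ι n * ((α : AddMonoid.End M) x * y)
    rw [α.2.1, mul_assoc]
  | h2 z w hz hw => simp only [map_add, hz, hw, mul_add]

/-- The map `b¹ ⊗ b² ↦ f(b¹) b²` for an endomorphism `f` of the right `N`-module `M`. -/
def evalEndRight (f : endRight ι) : TensorSq ι →+ M :=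
  BalTensor.lift (fun x y => (f : AddMonoid.End M) x * y)
    (fun x x' y => by rw [map_add, add_mul]) (fun x y y' => mul_add _ _ _)
    (fun n x y => by
      change (f : AddMonoid.End M) (x * ι n) * y = (f : AddMonoid.End M) x * (ι n * y)
      rw [f.2, mul_assoc])

theorem evalEndRight_tmul (f : endRight ι) (x y : M) :
    evalEndRight f (tmul ι x y) = (f : AddMonoid.End M) x * y := rfl

theorem evalEndRight_rmul (f : endRight ι) (m : M) (z : TensorSq ι) :
    evalEndRight f (rmul ι m z) = evalEndRight f z * m := by
  induction z using BalTensor.induction with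
  | h0 => simp
  | h1 x y => exact (mul_assoc _ _ _).symm
  | h2 z w hz hw => simp only [map_add, hz, hw, add_mul]

theorem evalLeft_rmul (α : endBimod ι) (m : M) (z : TensorSq ι) :
    evalLeft α (rmul ι m z) = evalLeft α z * m := by
  induction z using BalTensor.induction with
  | h0 => simp
  | h1 x y => exact (mul_assoc _ _ _).symm
  | h2 z w hz hw => simp only [map_add, hz, hw, add_mul]

theorem lmul_rmul (m m' : M) (z : TensorSq ι) :
    lmul ι m (rmul ι m' z) = rmul ι m' (lmul ι m z) := by
  induction z using BalTensor.induction with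
  | h0 => simp
  | h1 x y => rfl
  | h2 z w hz hw => simp only [map_add, hz, hw]

theorem evalRight_lmul (α : endBimod ι) (m : M) (z : TensorSq ι) :
    evalRight α (lmul ι m z) = m * evalRight α z := by
  induction z using BalTensor.induction with
  | h0 => simp
  | h1 x y => exact mul_assoc _ _ _
  | h2 z w hz hw => simp only [map_add, hz, hw, mul_add]

/-- The element `α(b¹) b²` of the centralizer. -/
def pairing (α : endBimod ι) (b : centralizer ι) : centralizerRing ι :=
  ⟨evalLeft α b, by
    rintro _ ⟨n, rfl⟩
    -- n α(b¹)b² = α(n b¹)b² = α(b¹)b² n, since α is left N-linear and nb = bn.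
    rw [← evalLeft_lmul, b.2, evalLeft_rmul]⟩

theorem pairing_add (α α' : endBimod ι) (b : centralizer ι) :
    pairing (α + α') b = pairing α b + pairing α' b := by
  ext
  change evalLeft (α + α') (b : TensorSq ι) = evalLeft α b + evalLeft α' b
  generalize (b : TensorSq ι) = z
  induction z using BalTensor.induction with
  | h0 => simp
  | h1 x y => exact add_mul _ _ _
  | h2 z w hz hw => simp only [map_add, hz, hw]; abel

end TensorSq

open TensorSq

/-! ### Existence of left quasibases -/

theorem endBimod_ext {α β : endBimod ι}
    (h : ∀ m, (α : AddMonoid.End M) m = (β : AddMonoid.End M) m) : α = β :=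
  Subtype.ext (AddMonoidHom.ext h)

/-- An N-M-bimodule map M → M ⊗_N M is given by the image of 1, an element of B, and one M ⊗_N M → M
is given by m ↦ φ(m ⊗ 1), an element of A. The components of g and f thus supply the bᵢ and the βᵢ,
and g ∘ f = id evaluated at m ⊗ 1 is the quasibasis identity. -/
theorem IsLeftD2.exists_isLeftQuasibasis (h : IsLeftD2 ι) :
    ∃ (k : ℕ) (b : Fin k → centralizer ι) (β : Fin k → endBimod ι), IsLeftQuasibasis ι b β := by
  obtain ⟨k, -, f, g, fl, fr, gl, gr, hgf⟩ := h
  refine ⟨k, fun i => ⟨g (Pi.single i 1), fun n => ?_⟩,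
    fun i => ⟨AddMonoidHom.mk' (fun m => f (tmul ι m 1) i) fun m m' => ?_, fun n m => ?_,
      fun m n => ?_⟩, fun m => ?_⟩
  -- The standard basis vector eᵢ satisfies n eᵢ = eᵢ n, hence so does its image under g.
  · rw [← gl, ← gr]
    congr 1
    ext j
    rcases eq_or_ne j i with rfl | hj <;> simp [*]
  · rw [tmul, BalTensor.add_mk, map_add, Pi.add_apply]
  · exact congrFun (fl n (tmul ι m 1)) i
  · change f (tmul ι (m * ι n) 1) i = f (tmul ι m 1) i * ι n
    -- Moving n across the tensor turns right N-linearity of βᵢ into right M-linearity of f.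
    have h : tmul ι (m * ι n) 1 = rmul ι (ι n) (tmul ι m 1) := by
      refine (BalTensor.mk_bal (ρ := extRAct ι) (l := extLAct ι) n m 1).trans ?_
      change tmul ι m (ι n * 1) = tmul ι m (1 * ι n)
      rw [mul_one, one_mul]
    rw [h, fr]
  · change ∑ i, rmul ι (f (tmul ι m 1) i) (g (Pi.single i 1)) = _
    conv_rhs => rw [← hgf (tmul ι m 1), ← Finset.univ_sum_single (f (tmul ι m 1)), map_sum]
    refine Finset.sum_congr rfl fun i _ => ?_
    rw [← gr]
    congr 1
    ext j
    rcases eq_or_ne j i with rfl | hj <;> simp [*]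

/-! ### Source and target of A -/

variable (ι) in
/-- The source `r ↦ λ(r)` and the target `r ↦ ρ(r)` of `A = End _N M_N` over `R = C_M(N)`. -/
def endBimodSourceTarget : SourceTarget (centralizerRing ι) (endBimod ι) where
  s :=
    { toFun := fun r => ⟨AddMonoidHom.mulLeft (r : M), fun n x => by
          change (r : M) * (ι n * x) = ι n * (r * x)
          rw [← mul_assoc, ← r.2 _ ⟨n, rfl⟩, mul_assoc], fun x n => (mul_assoc _ _ _).symm⟩
      map_one' := Subtype.ext (AddMonoidHom.ext fun x => one_mul x)
      map_zero' := Subtype.ext (AddMonoidHom.ext fun x => zero_mul x)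
      map_mul' := fun r r' => Subtype.ext (AddMonoidHom.ext fun x => mul_assoc (r : M) r' x)
      map_add' := fun r r' => Subtype.ext (AddMonoidHom.ext fun x => add_mul (r : M) r' x) }
  t :=
    { toFun := fun r => ⟨AddMonoidHom.mulRight (r.unop : M), fun n x => mul_assoc _ _ _,
        fun x n => by
          change x * ι n * (r.unop : M) = x * r.unop * ι n
          rw [mul_assoc, r.unop.2 _ ⟨n, rfl⟩, mul_assoc]⟩
      map_one' := Subtype.ext (AddMonoidHom.ext fun x => mul_one x)
      map_zero' := Subtype.ext (AddMonoidHom.ext fun x => mul_zero x)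
      map_mul' := fun r r' =>
        Subtype.ext (AddMonoidHom.ext fun x => (mul_assoc x (r'.unop : M) r.unop).symm)
      map_add' := fun r r' =>
        Subtype.ext (AddMonoidHom.ext fun x => mul_add x (r.unop : M) r'.unop) }
  comm r r' := Subtype.ext (AddMonoidHom.ext fun x => (mul_assoc (r : M) x r').symm)

/-! ### Coordinates on X ⊗_R A from the dual basis -/

section Coordinates

variable {X : Type*} [AddCommGroup X] {ρ : centralizerRing ι → AddMonoid.End X}
  (hadd : ∀ r r' x, ρ (r + r') x = ρ r x + ρ r' x) (hmul : ∀ r r' x, ρ (r * r') x = ρ r' (ρ r x))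

/-- The coordinate `x ⊗ α ↦ x · α(b¹) b²` of `X ⊗_R A` at `b ∈ B`. -/
def coord (b : centralizer ι) : BalTensor ρ (endBimodSourceTarget ι).lAct →+ X :=
  BalTensor.lift (fun x α => ρ (pairing α b) x) (fun x x' α => map_add _ _ _)
    (fun x α α' => by rw [pairing_add, hadd])
    (fun r x α => by
      -- Balancedness comes from left R-linearity of the pairing in α.
      rw [← hmul]
      congr 2
      ext
      change (r : M) * evalLeft α b = evalLeft ((endBimodSourceTarget ι).s r * α) b
      generalize (b : TensorSq ι) = z
      induction z using BalTensor.induction with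
      | h0 => simp
      | h1 x y => exact (mul_assoc _ _ _).symm
      | h2 z w hz hw => simp only [map_add, mul_add, hz, hw])

theorem coord_mk (b : centralizer ι) (x : X) (α : endBimod ι) :
    coord hadd hmul b (BalTensor.mk _ _ x α) = ρ (pairing α b) x := rfl

/-- The map x ⊗ y ↦ f(x)y, applied to the quasibasis identity at m. Right N-linearity of f suffices,
so this serves both A and all of End(M_N). -/
theorem sum_mul_quasibasis {k : ℕ} {b : Fin k → centralizer ι} {β : Fin k → endBimod ι}
    (h : IsLeftQuasibasis ι b β) (f : endRight ι) (m : M) :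
    ∑ i, evalEndRight f (b i : TensorSq ι) * (β i : AddMonoid.End M) m =
      (f : AddMonoid.End M) m := by
  simpa only [map_sum, evalEndRight_rmul, evalEndRight_tmul, mul_one]
    using congrArg (evalEndRight f) (h m)

theorem sum_apply_endBimod {I : Type*} (s : Finset I) (f : I → endBimod ι) (m : M) :
    ((∑ i ∈ s, f i : endBimod ι) : AddMonoid.End M) m =
      ∑ i ∈ s, (f i : AddMonoid.End M) m :=
  map_sum (AddMonoidHom.mk' (fun α : endBimod ι => (α : AddMonoid.End M) m) fun _ _ => rfl) f s

/-- On x ⊗ α, the coefficients α(bᵢ¹)bᵢ² lie in R and can be moved across the tensor sign, where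
they reassemble α from the βᵢ. -/
theorem sum_coord {k : ℕ} {b : Fin k → centralizer ι} {β : Fin k → endBimod ι}
    (h : IsLeftQuasibasis ι b β)
    (z : BalTensor ρ (endBimodSourceTarget ι).lAct) :
    ∑ i, BalTensor.mk ρ (endBimodSourceTarget ι).lAct (coord hadd hmul (b i) z) (β i) = z := by
  induction z using BalTensor.induction with
  | h0 =>
    simp only [map_zero, BalTensor.zero_mk, Finset.sum_const_zero]
  | h1 x α =>
    have hα : ∑ i, (endBimodSourceTarget ι).lAct (pairing α (b i)) (β i) = α :=
      Subtype.ext (AddMonoidHom.ext fun m =>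
        (sum_apply_endBimod Finset.univ
          (fun i => (endBimodSourceTarget ι).lAct (pairing α (b i)) (β i)) m).trans
          (sum_mul_quasibasis h (⟨α, α.2.2⟩ : endRight ι) m))
    conv_rhs => rw [← hα, BalTensor.mk_sum]
    refine Finset.sum_congr rfl fun i _ => ?_
    rw [coord_mk, ← BalTensor.mk_bal]
  | h2 z w hz hw =>
    simp only [map_add, BalTensor.add_mk, Finset.sum_add_distrib, hz, hw]

end Coordinates

/-! ### Tensors as multivariable functions, and the bialgebroid A -/

section Coproduct

/-- The map `A ⊗_R A → M`, `α ⊗ β ↦ α(x) β(y)`. -/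
def evalPair (x y : M) : (endBimodSourceTarget ι).Tensor →+ M :=
  BalTensor.lift (fun α β => (α : AddMonoid.End M) x * (β : AddMonoid.End M) y)
    (fun _ _ _ => add_mul _ _ _) (fun _ _ _ => mul_add _ _ _) (fun _ _ _ => mul_assoc _ _ _)

/-- The coordinate `α ⊗ α' ↦ α(-) α'(b¹) b²` of `A ⊗_R A`. -/
def tensorCoord (b : centralizer ι) : (endBimodSourceTarget ι).Tensor →+ endBimod ι :=
  coord (fun r r' α => endBimod_ext fun x => mul_add ((α : AddMonoid.End M) x) (r : M) r')
    (fun r r' α => endBimod_ext fun x => (mul_assoc ((α : AddMonoid.End M) x) (r : M) r').symm) b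

theorem sum_tensorCoord {k : ℕ} {b : Fin k → centralizer ι} {β : Fin k → endBimod ι}
    (h : IsLeftQuasibasis ι b β) (z : (endBimodSourceTarget ι).Tensor) :
    ∑ i, (endBimodSourceTarget ι).tmul (tensorCoord (b i) z) (β i) = z :=
  sum_coord _ _ h z

/-- This linearity is what allows the coordinate to be applied to the inner factor of A ⊗_R (A ⊗_R
A). -/
theorem tensorCoord_lActTensor (b : centralizer ι) (r : centralizerRing ι)
    (z : (endBimodSourceTarget ι).Tensor) :
    tensorCoord b ((endBimodSourceTarget ι).lActTensor r z) =
      (endBimodSourceTarget ι).lAct r (tensorCoord b z) := by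
  induction z using BalTensor.induction with
  | h0 => simp
  | h1 α α' => exact Subtype.ext (AddMonoidHom.ext fun x => mul_assoc _ _ _)
  | h2 z w hz hw => simp only [map_add, hz, hw]

/-- If `b = ∑ uᵢ ⊗ vᵢ`, then the coordinate of `z` at `b` is `x ↦ ∑ z(x, uᵢ) vᵢ`. -/
theorem tensorCoord_apply (b : centralizer ι) {n : ℕ} {u v : Fin n → M}
    (hb : (b : TensorSq ι) = ∑ i, tmul ι (u i) (v i)) (z : (endBimodSourceTarget ι).Tensor)
    (x : M) : (tensorCoord b z : AddMonoid.End M) x = ∑ i, evalPair x (u i) z * v i := by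
  induction z using BalTensor.induction with
  | h0 => simp
  | h1 α α' =>
    change (α : AddMonoid.End M) x * evalLeft α' b = _
    rw [hb, map_sum, Finset.mul_sum]
    exact Finset.sum_congr rfl fun i _ => (mul_assoc _ _ _).symm
  | h2 z w hz hw =>
    simp only [map_add, add_mul, Finset.sum_add_distrib, ← hz, ← hw]
    rfl

/-- The coordinates at a quasibasis determine a tensor, and by `tensorCoord_apply` they involve only
its values on pairs. -/
theorem evalPair_ext (h : IsLeftD2 ι) {z w : (endBimodSourceTarget ι).Tensor}
    (hzw : ∀ x y, evalPair x y z = evalPair x y w) : z = w := by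
  obtain ⟨k, b, β, hb⟩ := h.exists_isLeftQuasibasis
  rw [← sum_tensorCoord hb z, ← sum_tensorCoord hb w]
  refine Finset.sum_congr rfl fun i _ => ?_
  congr 1
  obtain ⟨n, u, v, huv⟩ := BalTensor.exists_sum (b i : TensorSq ι)
  refine endBimod_ext fun x => ?_
  rw [tensorCoord_apply _ huv, tensorCoord_apply _ huv]
  simp only [hzw]

/-- The map `A ⊗_R (A ⊗_R A) → M`, `α ⊗ (β ⊗ γ) ↦ α(x) β(y) γ(z)`. -/
def evalTriple (x y z : M) : (endBimodSourceTarget ι).TensorR →+ M :=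
  BalTensor.lift (fun α X => (α : AddMonoid.End M) x * evalPair y z X)
    (fun _ _ _ => add_mul _ _ _) (fun _ _ _ => by rw [map_add, mul_add])
    (fun r α X => by
      induction X using BalTensor.induction with
      | h0 => simp
      | h1 β γ =>
        change (α : AddMonoid.End M) x * r * ((β : AddMonoid.End M) y * (γ : AddMonoid.End M) z) =
          (α : AddMonoid.End M) x * (r * (β : AddMonoid.End M) y * (γ : AddMonoid.End M) z)
        simp only [mul_assoc]
      | h2 z w hz hw => simp only [map_add, mul_add, hz, hw])

theorem evalTriple_mk (x y z : M) (α : endBimod ι) (X : (endBimodSourceTarget ι).Tensor) :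
    evalTriple x y z (BalTensor.mk _ _ α X) = (α : AddMonoid.End M) x * evalPair y z X := rfl

/-- The coordinate `α ⊗ (β ⊗ γ) ↦ α ⊗ β(-) γ(b¹) b²` of `A ⊗_R (A ⊗_R A)`. -/
def tripleCoord (b : centralizer ι) :
    (endBimodSourceTarget ι).TensorR →+ (endBimodSourceTarget ι).Tensor :=
  BalTensor.map (AddMonoidHom.id _) (tensorCoord b) (fun _ _ => rfl)
    (fun r z => tensorCoord_lActTensor b r z)

/-- The reconstruction for A ⊗_R A takes place inside the second factor; `assoc` then brings βᵢ out
as the last factor. -/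
theorem sum_tripleCoord {k : ℕ} {b : Fin k → centralizer ι} {β : Fin k → endBimod ι}
    (h : IsLeftQuasibasis ι b β) (z : (endBimodSourceTarget ι).TensorR) :
    ∑ i, (endBimodSourceTarget ι).assoc (BalTensor.mk _ _ (tripleCoord (b i) z) (β i)) = z := by
  induction z using BalTensor.induction with
  | h0 =>
    simp only [map_zero, BalTensor.zero_mk, Finset.sum_const_zero]
  | h1 α X =>
    conv_rhs => rw [← sum_tensorCoord h X, BalTensor.mk_sum]
    rfl
  | h2 z w hz hw => simp only [map_add, BalTensor.add_mk, Finset.sum_add_distrib, hz, hw]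

theorem evalPair_tripleCoord (b : centralizer ι) {n : ℕ} {u v : Fin n → M}
    (hb : (b : TensorSq ι) = ∑ i, tmul ι (u i) (v i)) (z : (endBimodSourceTarget ι).TensorR)
    (x y : M) : evalPair x y (tripleCoord b z) = ∑ i, evalTriple x y (u i) z * v i := by
  induction z using BalTensor.induction with
  | h0 => simp
  | h1 α X =>
    change (α : AddMonoid.End M) x * (tensorCoord b X : AddMonoid.End M) y = _
    simp only [tensorCoord_apply b hb, Finset.mul_sum, evalTriple_mk, mul_assoc]
  | h2 z w hz hw => simp only [map_add, add_mul, Finset.sum_add_distrib, ← hz, ← hw]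

/-- Taking coordinates in the last factor reduces three variables to two, where `evalPair_ext`
applies. -/
theorem evalTriple_ext (h : IsLeftD2 ι) {z w : (endBimodSourceTarget ι).TensorR}
    (hzw : ∀ x y y', evalTriple x y y' z = evalTriple x y y' w) : z = w := by
  obtain ⟨k, b, β, hb⟩ := h.exists_isLeftQuasibasis
  rw [← sum_tripleCoord hb z, ← sum_tripleCoord hb w]
  refine Finset.sum_congr rfl fun i _ => ?_
  congr 2
  obtain ⟨n, u, v, huv⟩ := BalTensor.exists_sum (b i : TensorSq ι)
  refine evalPair_ext h fun x y => ?_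
  rw [evalPair_tripleCoord _ huv, evalPair_tripleCoord _ huv]
  simp only [hzw]

/-- Multiply the quasibasis identity at y by x on the left and apply u ⊗ v ↦ α(u)v: the result is ∑
α(x bᵢ¹)bᵢ² βᵢ(y) = α(xy). -/
theorem evalPair_sum_coeffLeft {k : ℕ} {b : Fin k → centralizer ι} {β : Fin k → endBimod ι}
    (h : IsLeftQuasibasis ι b β) (α : endBimod ι) (x y : M) :
    evalPair x y (∑ i, (endBimodSourceTarget ι).tmul (coeffLeft α (b i)) (β i)) =
      (α : AddMonoid.End M) (x * y) := by
  have h' := congrArg (fun z => evalLeft α (lmul ι x z)) (h y)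
  simp only [map_sum, lmul_rmul, evalLeft_rmul] at h' ⊢
  exact h'.trans (mul_one _)

/-- The mirror argument: multiply the identity at x by y on the right and apply u ⊗ v ↦ u α(v). -/
theorem evalPair_sum_coeffRight {k : ℕ} {c : Fin k → centralizer ι} {γ : Fin k → endBimod ι}
    (h : IsRightQuasibasis ι c γ) (α : endBimod ι) (x y : M) :
    evalPair x y (∑ i, (endBimodSourceTarget ι).tmul (γ i) (coeffRight (c i) α)) =
      (α : AddMonoid.End M) (x * y) := by
  have h' := congrArg (fun z => evalRight α (rmul ι y z)) (h x)
  simp only [map_sum, ← lmul_rmul, evalRight_lmul] at h' ⊢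
  exact h'.trans (one_mul _)

theorem exists_evalPair_eq (h : IsLeftD2 ι) (α : endBimod ι) :
    ∃ z : (endBimodSourceTarget ι).Tensor,
      ∀ x y, evalPair x y z = (α : AddMonoid.End M) (x * y) := by
  obtain ⟨k, b, β, hb⟩ := h.exists_isLeftQuasibasis
  exact ⟨_, evalPair_sum_coeffLeft hb α⟩

/-- The coproduct of `A = End _N M_N`, characterized by `α₍₁₎(x) α₍₂₎(y) = α(x y)`. -/
noncomputable def endBimodComul (h : IsLeftD2 ι) :
    endBimod ι →+ (endBimodSourceTarget ι).Tensor :=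
  AddMonoidHom.mk' (fun α => (exists_evalPair_eq h α).choose) fun α α' =>
    evalPair_ext h fun x y => by
      rw [map_add, (exists_evalPair_eq h _).choose_spec, (exists_evalPair_eq h _).choose_spec,
        (exists_evalPair_eq h _).choose_spec]
      rfl

theorem evalPair_comul (h : IsLeftD2 ι) (α : endBimod ι) (x y : M) :
    evalPair x y (endBimodComul h α) = (α : AddMonoid.End M) (x * y) :=
  (exists_evalPair_eq h α).choose_spec x y

theorem evalPair_lActTensor (r : centralizerRing ι) (x y : M)
    (z : (endBimodSourceTarget ι).Tensor) :
    evalPair x y ((endBimodSourceTarget ι).lActTensor r z) = r * evalPair x y z := by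
  induction z using BalTensor.induction with
  | h0 => simp
  | h1 α β => exact mul_assoc _ _ _
  | h2 z w hz hw => simp only [map_add, mul_add, hz, hw]

theorem evalPair_rActTensor (r : centralizerRing ι) (x y : M)
    (z : (endBimodSourceTarget ι).Tensor) :
    evalPair x y ((endBimodSourceTarget ι).rActTensor r z) = evalPair x y z * r := by
  induction z using BalTensor.induction with
  | h0 => simp
  | h1 α β => exact (mul_assoc _ _ _).symm
  | h2 z w hz hw => simp only [map_add, add_mul, hz, hw]

/-- Multiplication in A is composition, so right multiplication precomposes each variable. -/
theorem evalPair_rmul (β γ : endBimod ι) (x y : M) (z : (endBimodSourceTarget ι).Tensor) :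
    evalPair x y ((endBimodSourceTarget ι).rmul β γ z) =
      evalPair ((β : AddMonoid.End M) x) ((γ : AddMonoid.End M) y) z := by
  induction z using BalTensor.induction with
  | h0 => simp
  | h1 α β => rfl
  | h2 z w hz hw => simp only [map_add, hz, hw]

/-- Both sides evaluate at (x, y) to α(xry). -/
theorem endBimodComul_isTakeuchi (h : IsLeftD2 ι) (α : endBimod ι) :
    (endBimodSourceTarget ι).IsTakeuchi (endBimodComul h α) := fun r =>
  evalPair_ext h fun x y => by
    rw [evalPair_rmul, evalPair_rmul, evalPair_comul, evalPair_comul]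
    exact congrArg (α : AddMonoid.End M) (mul_assoc x (r : M) y)

/-- On β ⊗ γ the value is α₍₁₎(β(x)) α₍₂₎(γ(y)) = α(β(x)γ(y)). Taking z to be a coproduct gives
multiplicativity of Δ. -/
theorem evalPair_takMul_comul (h : IsLeftD2 ι) (α : endBimod ι) (x y : M)
    (z : (endBimodSourceTarget ι).Tensor) :
    evalPair x y ((endBimodSourceTarget ι).takMul _ (endBimodComul_isTakeuchi h α) z) =
      (α : AddMonoid.End M) (evalPair x y z) := by
  induction z using BalTensor.induction with
  | h0 => simp
  | h1 β γ => exact (evalPair_rmul β γ x y _).trans (evalPair_comul h α _ _)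
  | h2 z w hz hw => simp only [map_add, hz, hw]

theorem evalTriple_assoc_mk (x y y' : M) (X : (endBimodSourceTarget ι).Tensor) (α : endBimod ι) :
    evalTriple x y y' ((endBimodSourceTarget ι).assoc (BalTensor.mk _ _ X α)) =
      evalPair x y X * (α : AddMonoid.End M) y' := by
  induction X using BalTensor.induction with
  | h0 =>
    rw [BalTensor.zero_mk, map_zero, map_zero, map_zero, zero_mul]
  | h1 β γ => exact (mul_assoc _ _ _).symm
  | h2 z w hz hw => rw [BalTensor.add_mk, map_add, map_add, map_add, hz, hw, add_mul]

/-- The counit `ε(α) = α(1)` of `A = End _N M_N`. -/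
def endBimodCounit : endBimod ι →+ centralizerRing ι :=
  AddMonoidHom.mk' (fun α => ⟨(α : AddMonoid.End M) 1, by
    rintro _ ⟨n, rfl⟩
    -- Both n α(1) and α(1) n equal α(ι(n)).
    rw [← α.2.1, ← α.2.2, one_mul, mul_one]⟩) (fun _ _ => rfl)

/-- The left bialgebroid `A = End _N M_N` over `R = C_M(N)` of a left depth two extension. -/
noncomputable def endBimodBialgebroid (h : IsLeftD2 ι) :
    LeftBialgebroid (centralizerRing ι) (endBimod ι) where
  toSourceTarget := endBimodSourceTarget ι
  comul := endBimodComul h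
  counit := endBimodCounit
  comul_l r α := evalPair_ext h fun x y => by
    rw [evalPair_lActTensor, evalPair_comul, evalPair_comul]; rfl
  comul_r r α := evalPair_ext h fun x y => by
    rw [evalPair_rActTensor, evalPair_comul, evalPair_comul]; rfl
  counit_l r α := rfl
  counit_r r α := rfl
  coassoc α := evalTriple_ext h fun x y y' => by
    -- Coassociativity is associativity in M: the two sides evaluate to α((xy)y') and α(x(yy')).
    trans evalPair (x * y) y' (endBimodComul h α)
    · generalize endBimodComul h α = z
      induction z using BalTensor.induction with
      | h0 => simp
      | h1 β γ =>
        rw [BalTensor.map_mk, evalTriple_assoc_mk, evalPair_comul]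
        rfl
      | h2 z w hz hw => simp only [map_add, hz, hw]
    · rw [evalPair_comul, mul_assoc, ← evalPair_comul h]
      generalize endBimodComul h α = z
      induction z using BalTensor.induction with
      | h0 => simp
      | h1 β γ =>
        rw [BalTensor.map_mk, evalTriple_mk, evalPair_comul]
        rfl
      | h2 z w hz hw => simp only [map_add, hz, hw]
  counit_comul_left α := endBimod_ext fun x => by
    -- The counit evaluates the first leg at 1, so the claim is α₍₁₎(1) α₍₂₎(x) = α(1 · x).
    conv_rhs => rw [← one_mul x, ← evalPair_comul h]
    generalize endBimodComul h α = z
    induction z using BalTensor.induction with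
    | h0 => rw [map_zero, map_zero]; rfl
    | h1 β γ => rfl
    | h2 z w hz hw => rw [map_add, map_add, ← hz, ← hw]; rfl
  counit_comul_right α := endBimod_ext fun x => by
    conv_rhs => rw [← mul_one x, ← evalPair_comul h]
    generalize endBimodComul h α = z
    induction z using BalTensor.induction with
    | h0 => rw [map_zero, map_zero]; rfl
    | h1 β γ => rfl
    | h2 z w hz hw => rw [map_add, map_add, ← hz, ← hw]; rfl
  comul_takeuchi := endBimodComul_isTakeuchi h
  comul_mul α β := evalPair_ext h fun x y => by
    rw [evalPair_takMul_comul, evalPair_comul, evalPair_comul]; rfl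
  comul_one := evalPair_ext h fun x y => evalPair_comul h 1 x y
  counit_one := rfl
  counit_mul_s α β := Subtype.ext (congrArg (α : AddMonoid.End M) (mul_one _))
  counit_mul_t α β := Subtype.ext (congrArg (α : AddMonoid.End M) (one_mul _))

end Coproduct

/-! ### M as a module algebroid over A -/

/-- The module algebroid structure on `M` with `α ▷ m = α(m)`. -/
noncomputable def endBimodModuleAlgebroid (h : IsLeftD2 ι) :
    LeftModuleAlgebroid (endBimodBialgebroid h) M where
  act := (endBimod ι).subtype
  mul_bal _ _ _ := mul_assoc _ _ _
  -- The product rule is exactly the property characterizing Δ.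
  act_mul α x y := (evalPair_comul h α x y).symm
  act_one_bal _ := (mul_one _).trans (one_mul _).symm
  act_one _ := (mul_one _).symm

open LeftModuleAlgebroid

theorem endRight_ext {f g : endRight ι}
    (h : ∀ m, (f : AddMonoid.End M) m = (g : AddMonoid.End M) m) : f = g :=
  Subtype.ext (AddMonoidHom.ext h)

/-- Evaluation at `x`. -/
def endRightEval (x : M) : endRight ι →+ M :=
  AddMonoidHom.mk' (fun f => (f : AddMonoid.End M) x) fun _ _ => rfl

/-! ### The isomorphism of M ⋊ A with End(M_N) -/

section Smash

variable (h : IsLeftD2 ι)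

/-- The endomorphism `λ(m) ∘ α` of the right `N`-module `M`. -/
def mulLeftComp (m : M) (α : endBimod ι) : endRight ι :=
  ⟨(AddMonoidHom.mulLeft m).comp (α : AddMonoid.End M), fun x n => by
    change m * (α : AddMonoid.End M) (x * ι n) = m * (α : AddMonoid.End M) x * ι n
    rw [α.2.2, mul_assoc]⟩

/-- The additive map `m ⋊ α ↦ λ(m) ∘ α`. -/
noncomputable def smashToEndRightHom : (endBimodModuleAlgebroid h).Smash →+ endRight ι :=
  BalTensor.lift mulLeftComp (fun _ _ _ => endRight_ext fun _ => add_mul _ _ _)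
    (fun _ _ _ => endRight_ext fun _ => mul_add _ _ _)
    (fun r m α => endRight_ext fun x => by
      -- R acts on M through j(r) = s(r) ▷ 1, which unfolds to r · 1 rather than r.
      change m * ((r : M) * 1) * (α : AddMonoid.End M) x = m * (r * (α : AddMonoid.End M) x)
      rw [mul_one, mul_assoc])

/-- For z = Δ(α₀) this computes the image of (m ⋊ α₀)(m' ⋊ α) at x as m α₀(m' α(x)), which is
multiplicativity of the map. -/
theorem smashToEndRightHom_mulAux (m m' : M) (α : endBimod ι)
    (z : (endBimodBialgebroid h).Tensor) (x : M) :
    (smashToEndRightHom h (Smash.mulAux (endBimodModuleAlgebroid h) m m' α z) :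
      AddMonoid.End M) x = m * evalPair m' ((α : AddMonoid.End M) x) z := by
  have key : (endRightEval x).comp ((smashToEndRightHom h).comp
      (Smash.mulAux (endBimodModuleAlgebroid h) m m' α)) =
      (AddMonoidHom.mulLeft m).comp (evalPair m' ((α : AddMonoid.End M) x)) :=
    BalTensor.hom_ext fun _ _ => mul_assoc _ _ _
  exact DFunLike.congr_fun key z

/-- The ring homomorphism `m ⋊ α ↦ λ(m) ∘ α` from `M ⋊ A` to `End M_N`. -/
noncomputable def smashToEndRight : (endBimodModuleAlgebroid h).Smash →+* endRight ι :=
  { smashToEndRightHom h with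
    map_one' := endRight_ext fun x => one_mul x
    map_mul' := fun z w => by
      change smashToEndRightHom h (z * w) = smashToEndRightHom h z * smashToEndRightHom h w
      induction z using Smash.induction with
      | h0 => rw [zero_mul, map_zero, zero_mul]
      | h2 z z' hz hz' => rw [add_mul, map_add, map_add, add_mul, hz, hz']
      | h1 m α =>
      induction w using Smash.induction with
      | h0 => rw [mul_zero, map_zero, mul_zero]
      | h2 w w' hw hw' => rw [mul_add, map_add, map_add, mul_add, hw, hw']
      | h1 m' α' =>
        refine endRight_ext fun x => ?_
        exact (smashToEndRightHom_mulAux h m m' α' (endBimodComul h α) x).trans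
          (congrArg (m * ·) (evalPair_comul h α _ _)) }

theorem endBimodModuleAlgebroid_rAct (r : centralizerRing ι) (m : M) :
    (endBimodModuleAlgebroid h).rAct r m = m * r :=
  congrArg (m * ·) (mul_one (r : M))

/-- The coordinate `m ⋊ α ↦ m α(b¹) b²` of `M ⋊ A`. -/
noncomputable def smashCoord (b : centralizer ι) : (endBimodModuleAlgebroid h).Smash →+ M :=
  coord (ρ := (endBimodModuleAlgebroid h).rAct)
    (fun r r' m => by
      rw [endBimodModuleAlgebroid_rAct, endBimodModuleAlgebroid_rAct,
        endBimodModuleAlgebroid_rAct]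
      exact mul_add m (r : M) r')
    (fun r r' m => by
      rw [endBimodModuleAlgebroid_rAct, endBimodModuleAlgebroid_rAct,
        endBimodModuleAlgebroid_rAct]
      exact (mul_assoc m (r : M) r').symm) b

theorem sum_smashCoord {k : ℕ} {b : Fin k → centralizer ι} {β : Fin k → endBimod ι}
    (hb : IsLeftQuasibasis ι b β) (z : (endBimodModuleAlgebroid h).Smash) :
    ∑ i, Smash.mk (endBimodModuleAlgebroid h) (smashCoord h (b i) z) (β i) = z :=
  sum_coord (ρ := (endBimodModuleAlgebroid h).rAct) _ _ hb z

/-- On m ⋊ α both sides are m α(b¹)b². Hence the coordinates see only the induced endomorphism,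
which forces injectivity. -/
theorem smashCoord_eq (b : centralizer ι) (z : (endBimodModuleAlgebroid h).Smash) :
    smashCoord h b z = evalEndRight (smashToEndRight h z) b := by
  induction z using Smash.induction with
  | h0 =>
    rw [map_zero, map_zero]
    generalize (b : TensorSq ι) = w
    induction w using BalTensor.induction with
    | h0 => simp
    | h1 x y => exact (zero_mul y).symm
    | h2 v w hv hw => rw [map_add, ← hv, ← hw, add_zero]
  | h1 m α =>
    refine (endBimodModuleAlgebroid_rAct h (pairing α b) m).trans ?_
    change m * evalLeft α b = evalEndRight (mulLeftComp m α) b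
    generalize (b : TensorSq ι) = w
    induction w using BalTensor.induction with
    | h0 => simp
    | h1 x y => exact (mul_assoc _ _ _).symm
    | h2 v w hv hw => rw [map_add, map_add, mul_add, hv, hw]
  | h2 z w hz hw =>
    rw [map_add, map_add, hz, hw]
    generalize (b : TensorSq ι) = v
    induction v using BalTensor.induction with
    | h0 => simp
    | h1 x y => exact (add_mul _ _ _).symm
    | h2 u v hu hv => simp only [map_add, ← hu, ← hv]; abel

theorem smashToEndRight_bijective : Function.Bijective (smashToEndRight h) := by
  obtain ⟨k, b, β, hb⟩ := h.exists_isLeftQuasibasis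
  refine ⟨fun z w hzw => ?_, fun f =>
    -- The preimage of f is ∑ f(bᵢ¹)bᵢ² ⋊ βᵢ, by the expansion of f along a quasibasis.
    ⟨∑ i, Smash.mk _ (evalEndRight f (b i : TensorSq ι)) (β i), endRight_ext fun x => ?_⟩⟩
  · rw [← sum_smashCoord h hb z, ← sum_smashCoord h hb w]
    simp only [smashCoord_eq, hzw]
  · rw [map_sum, ← sum_mul_quasibasis hb f x]
    exact map_sum (endRightEval x) _ _

/-- The isomorphism `M ⋊ A ≃ End M_N`, `m ⋊ α ↦ λ(m) ∘ α`. -/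
noncomputable def smashEquivEndRight : (endBimodModuleAlgebroid h).Smash ≃+* endRight ι :=
  RingEquiv.ofBijective (smashToEndRight h) (smashToEndRight_bijective h)

end Smash

/-! ### The isomorphism of End(M_N) with M₁ for Frobenius extensions -/

namespace FrobeniusSystem

variable (F : FrobeniusSystem ι)

/-- The additive map `m ⊗ m' ↦ λ(m) ∘ E ∘ λ(m')` from `M₁` to `End M_N`. -/
def toEndRight : F.BasicConstruction →+ endRight ι :=
  BalTensor.lift (ρ := extRAct ι) (l := extLAct ι)
    (fun m m' => ⟨AddMonoidHom.mk' (fun x => m * ι (F.E (m' * x)))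
      (fun x x' => by rw [mul_add, map_add, map_add, mul_add]), fun x n => by
        change m * ι (F.E (m' * (x * ι n))) = m * ι (F.E (m' * x)) * ι n
        rw [← mul_assoc m', F.E_right, map_mul ι, mul_assoc]⟩)
    (fun m n m' => endRight_ext fun x => add_mul _ _ _)
    (fun m m' n' => endRight_ext fun x => by
      change m * ι (F.E ((m' + n') * x)) = m * ι (F.E (m' * x)) + m * ι (F.E (n' * x))
      rw [add_mul, map_add, map_add, mul_add])
    (fun n m m' => endRight_ext fun x => by
      change m * ι n * ι (F.E (m' * x)) = m * ι (F.E (ι n * m' * x))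
      rw [mul_assoc (ι n), F.E_left, map_mul ι, mul_assoc])

theorem toEndRight_mk_apply (m m' x : M) :
    (F.toEndRight (BasicConstruction.mk F m m') : AddMonoid.End M) x = m * ι (F.E (m' * x)) :=
  rfl

/-- Right N-linearity of E gives m E(m'p E(p'x)) = m E(m'p) E(p'x), which is the E-multiplication.
-/
theorem toEndRight_mul (z w : F.BasicConstruction) :
    F.toEndRight (z * w) = F.toEndRight z * F.toEndRight w := by
  induction z using BasicConstruction.induction with
  | h0 => rw [zero_mul, map_zero, zero_mul]
  | h2 z z' hz hz' => rw [add_mul, map_add, map_add, add_mul, hz, hz']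
  | h1 m m' =>
  induction w using BasicConstruction.induction with
  | h0 => rw [mul_zero, map_zero, mul_zero]
  | h2 w w' hw hw' => rw [mul_add, map_add, map_add, mul_add, hw, hw']
  | h1 p p' =>
    refine endRight_ext fun x => ?_
    rw [BasicConstruction.mk_mul_mk, toEndRight_mk_apply]
    change _ = m * ι (F.E (m' * (p * ι (F.E (p' * x)))))
    rw [← mul_assoc m', F.E_right, map_mul ι, mul_assoc]

/-- The additive map `f ↦ ∑ f(xᵢ) ⊗ yᵢ` from `End M_N` to `M₁`. -/
def ofEndRight (f : endRight ι) : F.BasicConstruction :=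
  ∑ i, BasicConstruction.mk F ((f : AddMonoid.End M) (F.x i)) (F.y i)

/-- Apply f to x = ∑ xᵢ E(yᵢx) and use right N-linearity. -/
theorem toEndRight_ofEndRight (f : endRight ι) : F.toEndRight (F.ofEndRight f) = f := by
  refine endRight_ext fun x => ?_
  conv_rhs => rw [← F.sum_left x, map_sum]
  rw [ofEndRight, map_sum]
  refine (map_sum (endRightEval x) _ _).trans (Finset.sum_congr rfl fun i _ => ?_)
  exact (f.2 _ _).symm

/-- On m ⊗ m', the factors E(m'xᵢ) ∈ N cross the tensor sign and ∑ E(m'xᵢ)yᵢ = m'. -/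
theorem ofEndRight_toEndRight (z : F.BasicConstruction) :
    F.ofEndRight (F.toEndRight z) = z := by
  induction z using BasicConstruction.induction with
  | h0 =>
    rw [map_zero]
    exact Finset.sum_eq_zero fun i _ => BalTensor.zero_mk _
  | h1 m m' =>
    simp only [ofEndRight, toEndRight_mk_apply, BasicConstruction.mk_bal]
    conv_rhs => rw [← F.sum_right m']
    exact (BalTensor.mk_sum _ _ _).symm
  | h2 z w hz hw =>
    conv_rhs => rw [← hz, ← hw]
    rw [map_add, ofEndRight, ofEndRight, ofEndRight, ← Finset.sum_add_distrib]
    exact Finset.sum_congr rfl fun i _ => BasicConstruction.add_mk _ _ _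

/-- The isomorphism `End M_N ≃ M₁`, `f ↦ ∑ f(xᵢ) ⊗ yᵢ`. -/
def endRightEquiv : endRight ι ≃+* F.BasicConstruction :=
  -- Multiplicativity is checked in the direction M₁ → End(M_N), where products are composites of
  -- explicit endomorphisms.
  RingEquiv.symm
    { toFun := F.toEndRight
      invFun := F.ofEndRight
      left_inv := F.ofEndRight_toEndRight
      right_inv := F.toEndRight_ofEndRight
      map_mul' := F.toEndRight_mul
      map_add' := map_add F.toEndRight }

end FrobeniusSystem

end DepthTwo

theorem mainTheorem6 {N M : Type*} [Ring N] [Ring M] (ι : N →+* M) (hD2 : IsLeftD2 ι) :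
    ∃ (𝒜 : LeftBialgebroid (centralizerRing ι) (endBimod ι)) (𝓜 : LeftModuleAlgebroid 𝒜 M),
      -- the bialgebroid `A = End _N M_N` over `R = C_M(N)`: `s = λ`, `t = ρ`, `ε(α) = α(1)`
      (∀ r m, (𝒜.s r : AddMonoid.End M) m = r * m) ∧
      (∀ r m, (𝒜.t (MulOpposite.op r) : AddMonoid.End M) m = m * r) ∧
      (∀ α, (𝒜.counit α : M) = (α : AddMonoid.End M) 1) ∧
      -- `Δ(α) = ∑ α(- bᵢ¹) bᵢ² ⊗ βᵢ = ∑ γⱼ ⊗ cⱼ¹ α(cⱼ² -)` for left and right quasibases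
      (∃ (k : ℕ) (b : Fin k → TensorSq.centralizer ι) (β : Fin k → endBimod ι),
        IsLeftQuasibasis ι b β) ∧
      (∀ (k : ℕ) (b : Fin k → TensorSq.centralizer ι) (β : Fin k → endBimod ι),
        IsLeftQuasibasis ι b β → ∀ α, 𝒜.comul α = ∑ i, 𝒜.tmul (coeffLeft α (b i)) (β i)) ∧
      (∀ (k : ℕ) (c : Fin k → TensorSq.centralizer ι) (γ : Fin k → endBimod ι),
        IsRightQuasibasis ι c γ → ∀ α, 𝒜.comul α = ∑ i, 𝒜.tmul (γ i) (coeffRight (c i) α)) ∧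
      -- the action of `A` on `M` is evaluation
      (∀ α m, 𝓜.act α m = (α : AddMonoid.End M) m) ∧
      -- `M ⋊ A ≅ End M_N` by `m ⋊ α ↦ λ(m) ∘ α`
      (∃ π : 𝓜.Smash ≃+* endRight ι, ∀ m α,
        (π (LeftModuleAlgebroid.Smash.mk 𝓜 m α) : AddMonoid.End M) =
          (AddMonoidHom.mulLeft m).comp (α : AddMonoid.End M)) ∧
      -- if `M | N` is Frobenius, then `M ⋊ A ≅ M₁` by `m ⋊ α ↦ ∑ m α(xᵢ) e₁ yᵢ`
      (∀ F : FrobeniusSystem ι, ∃ P : 𝓜.Smash ≃+* F.BasicConstruction, ∀ m α,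
        P (LeftModuleAlgebroid.Smash.mk 𝓜 m α) =
          ∑ i, FrobeniusSystem.BasicConstruction.mk F
            (m * (α : AddMonoid.End M) (F.x i)) (F.y i)) :=
  ⟨endBimodBialgebroid hD2, endBimodModuleAlgebroid hD2, fun _ _ => rfl, fun _ _ => rfl,
    fun _ => rfl, hD2.exists_isLeftQuasibasis,
    -- Each quasibasis formula has the value α(xy) on every pair (x, y), so it equals Δ(α).
    fun _ _ _ hb α => evalPair_ext hD2 fun x y =>
      (evalPair_comul hD2 α x y).trans (evalPair_sum_coeffLeft hb α x y).symm,
    fun _ _ _ hc α => evalPair_ext hD2 fun x y =>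
      (evalPair_comul hD2 α x y).trans (evalPair_sum_coeffRight hc α x y).symm,
    fun _ _ => rfl, ⟨smashEquivEndRight hD2, fun _ _ => rfl⟩,
    fun F => ⟨(smashEquivEndRight hD2).trans F.endRightEquiv, fun _ _ => rfl⟩⟩
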